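/- Let $\Omega\subset\mathbb{R}^d$ be a bounded open connected (nonempty) set with $\partial\Omega\in C^1$, let $T>0$ and $Q=\Omega\times(0,T]$. Assume: (A1) $\mathcal{D}\in C^1(\mathbb{R}^2)$ and $0<\mathcal{D}_m\le \mathcal{D}\le \mathcal{D}_M<\infty$ for constants $\mathcal{D}_m,\mathcal{D}_M$; (A2) $F:\mathbb{R}^2\to\mathbb{R}^d$ has $C^1$ components and $|F|\le F_M$ for some $F_M>0$; (A3) there are constants $\Psi_u,\Psi_v>0$ such that for $j\in\{1,2\}$, $|\Psi_j(u_1,v_1)-\Psi_j(u_2,v_2)|\le \Psi_u|u_1-u_2|+\Psi_v|v_1-v_2|$ for all $u_1,u_2,v_1,v_2\in\mathbb{R}$, and $\Psi_1,\Psi_2:\mathbb{R}^2\to\mathbb{R}$ are nonincreasing in each of their two variables; (A4) $u_0\in L^\infty(\Omega)$, $v_0\in H^1(\Omega)\cap L^\infty(\Omega)$, and $\Psi_2(0,v_0)=0$ on $\partial\Omega$ in the sense of traces, i.e. $\Psi_2(0,v_0)\in H^1_0(\Omega)$. A weak solution is a pair $(u,v)$ with $u\in L^2(0,T;H^1_0(\Omega))$,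 $\partial_t u\in L^2(0,T;H^{-1}(\Omega))$, $v\in H^1(0,T;L^2(\Omega))\cap L^2(0,T;H^1(\Omega))$, $u(0)=u_0$, $v(0)=v_0$ (values at $t=0$ of the representatives in $C([0,T];L^2(\Omega))$), such that for all $\phi\in L^2(0,T;H^1_0(\Omega))$ and $\xi\in L^2(Q)$ $$\int_0^T\langle\partial_t u,\phi\rangle\,dt+\int_0^T\!\!\int_\Omega \mathcal{D}(u,v)\nabla u\cdot\nabla\phi\,dx\,dt=\int_0^T\!\!\int_\Omega F(u,v)\cdot\nabla\phi\,dx\,dt+\int_0^T\!\!\int_\Omega\Psi_1(u,v)\,\phi\,dx\,dt,$$ $$\int_0^T\!\!\int_\Omega \partial_t v\,\xi\,dx\,dt=\int_0^T\!\!\int_\Omega\Psi_2(u,v)\,\xi\,dx\,dt.$$ **Proposition (maximum principle).** Suppose in addition that $F(u,v)=F(u)$ does not depend on $v$. Let $v_l$ and $v_r$ be the essential infimum and the essential supremum of $v_0$ over $\Omega$, and suppose that there are real numbers $u_l<u_r$ with $u_l\le 0\le u_r$ such that $u_0(x)\in[u_l,u_r]$ for almost all $x\in\Omega$ and $$\Psi_1(u_r,v_l)\le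 0\le\Psi_2(u_r,v_l),\qquad \Psi_2(u_l,v_r)\le 0\le\Psi_1(u_l,v_r).$$ Then every weak solution $(u,v)$ satisfies $v_l\le v\le v_r$ and $u_l\le u\le u_r$ almost everywhere in $Q$. -/

import Mathlib

open MeasureTheory Filter Topology Set
open scoped ContDiff Gradient RealInnerProductSpace ENNReal

noncomputable section

/-- Euclidean space `ℝ^d`. -/
abbrev Euc (d : ℕ) : Type := EuclideanSpace ℝ (Fin d)

/-- `∂Ω ∈ C¹`: near each boundary point, `Ω` is the sublevel set `{ρ < 0}` of a `C¹` function `ρ`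
whose derivative does not vanish at that point. -/
def HasC1Boundary {d : ℕ} (Ω : Set (Euc d)) : Prop :=
  ∀ x₀ ∈ frontier Ω, ∃ (N : Set (Euc d)) (ρ : Euc d → ℝ), IsOpen N ∧ x₀ ∈ N ∧
    ContDiffOn ℝ 1 ρ N ∧ fderiv ℝ ρ x₀ ≠ 0 ∧ ∀ x ∈ N, x ∈ Ω ↔ ρ x < 0

/-- `L²(Ω)`. -/
abbrev L2 {d : ℕ} (Ω : Set (Euc d)) : Type := Lp ℝ 2 (volume.restrict Ω)

/-- `L²(Ω)^d`. -/
abbrev L2Vec {d : ℕ} (Ω : Set (Euc d)) : Type := Lp (Euc d) 2 (volume.restrict Ω)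

/-- Pairs `(f, G)` in `L²(Ω) × L²(Ω)^d`, with the Hilbert norm `(‖f‖² + ‖G‖²)^{1/2}`.
An element `f` of `H¹(Ω)` is represented by the pair `(f, ∇f)`. -/
abbrev L2Pair {d : ℕ} (Ω : Set (Euc d)) : Type := WithLp 2 (L2 Ω × L2Vec Ω)

/-- `φ ∈ C_c^∞(Ω)`, for `Ω` an open set of a normed space. -/
def IsTestFunction {X : Type*} [NormedAddCommGroup X] [NormedSpace ℝ X] (Ω : Set X)
    (φ : X → ℝ) : Prop :=
  ContDiff ℝ ∞ φ ∧ HasCompactSupport φ ∧ tsupport φ ⊆ Ω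

/-- A test function times an `L²` function is integrable. -/
lemma integrable_test_smul {d : ℕ} {Ω : Set (Euc d)} {X : Type*} [NormedAddCommGroup X]
    [NormedSpace ℝ X] {φ : Euc d → ℝ} (hφ : Continuous φ) (hc : HasCompactSupport φ)
    (g : Lp X 2 (volume.restrict Ω)) :
    Integrable (fun x => φ x • g x) (volume.restrict Ω) := by
  have h1 : MemLp φ 2 (volume.restrict Ω) :=
    (hφ.memLp_of_hasCompactSupport (μ := volume) hc).restrict Ω
  exact memLp_one_iff_integrable.1 ((Lp.memLp g).smul h1)

/-- An `L²` function times the gradient of a test function is integrable. -/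
lemma integrable_smul_grad {d : ℕ} {Ω : Set (Euc d)} {φ : Euc d → ℝ}
    (hφ : IsTestFunction Ω φ) (f : L2 Ω) :
    Integrable (fun x => f x • ∇ φ x) (volume.restrict Ω) := by
  have hcont : Continuous (fun x => ∇ φ x) :=
    (InnerProductSpace.toDual ℝ (Euc d)).symm.continuous.comp
      (hφ.1.continuous_fderiv (by simp))
  have hsupp : HasCompactSupport (fun x => ∇ φ x) :=
    (hφ.2.1.fderiv ℝ).comp_left (g := (InnerProductSpace.toDual ℝ (Euc d)).symm) (map_zero _)
  have h1 : MemLp (fun x => ∇ φ x) 2 (volume.restrict Ω) :=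
    (hcont.memLp_of_hasCompactSupport (μ := volume) hsupp).restrict Ω
  exact memLp_one_iff_integrable.1 (h1.smul (Lp.memLp f))

/-- The Sobolev space `H¹(Ω)`: pairs `(f, G)` of `L²` functions such that `G` is the weak gradient
of `f` in `Ω`. -/
def H1 {d : ℕ} (Ω : Set (Euc d)) : Submodule ℝ (L2Pair Ω) where
  carrier := {p | ∀ φ : Euc d → ℝ, IsTestFunction Ω φ →
    ∫ x in Ω, p.fst x • ∇ φ x = -∫ x in Ω, φ x • p.snd x}
  zero_mem' := by
    intro φ hφ
    have e1 : ∀ᵐ x ∂(volume.restrict Ω), ((0 : L2Pair Ω).fst x) • ∇ φ x = 0 := by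
      filter_upwards [Lp.coeFn_zero ℝ 2 (volume.restrict Ω)] with x hx
      rw [show (0 : L2Pair Ω).fst = 0 from rfl, hx, Pi.zero_apply, zero_smul]
    have e2 : ∀ᵐ x ∂(volume.restrict Ω), φ x • ((0 : L2Pair Ω).snd x) = 0 := by
      filter_upwards [Lp.coeFn_zero (Euc d) 2 (volume.restrict Ω)] with x hx
      rw [show (0 : L2Pair Ω).snd = 0 from rfl, hx, Pi.zero_apply, smul_zero]
    rw [integral_congr_ae e1, integral_congr_ae e2]
    simp
  add_mem' := by
    intro p q hp hq φ hφ
    have e1 : ∀ᵐ x ∂(volume.restrict Ω), ((p + q).fst x) • ∇ φ x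
        = p.fst x • ∇ φ x + q.fst x • ∇ φ x := by
      filter_upwards [Lp.coeFn_add p.fst q.fst] with x hx
      rw [show (p + q).fst = p.fst + q.fst from rfl, hx, Pi.add_apply, add_smul]
    have e2 : ∀ᵐ x ∂(volume.restrict Ω), φ x • ((p + q).snd x)
        = φ x • p.snd x + φ x • q.snd x := by
      filter_upwards [Lp.coeFn_add p.snd q.snd] with x hx
      rw [show (p + q).snd = p.snd + q.snd from rfl, hx, Pi.add_apply, smul_add]
    rw [integral_congr_ae e1, integral_congr_ae e2,
      integral_add (integrable_smul_grad hφ p.fst) (integrable_smul_grad hφ q.fst),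
      integral_add (integrable_test_smul hφ.1.continuous hφ.2.1 p.snd)
        (integrable_test_smul hφ.1.continuous hφ.2.1 q.snd), hp φ hφ, hq φ hφ, neg_add]
  smul_mem' := by
    intro c p hp φ hφ
    have e1 : ∀ᵐ x ∂(volume.restrict Ω), ((c • p).fst x) • ∇ φ x = c • (p.fst x • ∇ φ x) := by
      filter_upwards [Lp.coeFn_smul c p.fst] with x hx
      rw [show (c • p).fst = c • p.fst from rfl, hx, Pi.smul_apply, smul_assoc]
    have e2 : ∀ᵐ x ∂(volume.restrict Ω), φ x • ((c • p).snd x) = c • (φ x • p.snd x) := by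
      filter_upwards [Lp.coeFn_smul c p.snd] with x hx
      rw [show (c • p).snd = c • p.snd from rfl, hx, Pi.smul_apply, smul_comm]
    rw [integral_congr_ae e1, integral_congr_ae e2, integral_smul, integral_smul, hp φ hφ, smul_neg]

/-- The Sobolev space `H¹₀(Ω)`: the closure of `C_c^∞(Ω)` in the norm of `H¹(Ω)`. -/
def H10 {d : ℕ} (Ω : Set (Euc d)) : Submodule ℝ (L2Pair Ω) :=
  (Submodule.span ℝ {p : L2Pair Ω | ∃ φ : Euc d → ℝ, IsTestFunction Ω φ ∧
    p.fst =ᵐ[volume.restrict Ω] φ ∧ p.snd =ᵐ[volume.restrict Ω] ∇ φ}).topologicalClosure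

/-- The dual space `H⁻¹(Ω)` of `H¹₀(Ω)`. -/
abbrev Hneg1 {d : ℕ} (Ω : Set (Euc d)) : Type := H10 Ω →L[ℝ] ℝ

/-- The function `f` on `Ω` belongs to `H¹(Ω)`. -/
def MemH1 {d : ℕ} (Ω : Set (Euc d)) (f : Euc d → ℝ) : Prop :=
  ∃ p ∈ H1 Ω, p.fst =ᵐ[volume.restrict Ω] f

/-- The function `f` on `Ω` belongs to `H¹₀(Ω)`. -/
def MemH10 {d : ℕ} (Ω : Set (Euc d)) (f : Euc d → ℝ) : Prop :=
  ∃ p ∈ H10 Ω, p.fst =ᵐ[volume.restrict Ω] f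

/-- The embedding `L²(Ω) ⊂ H⁻¹(Ω)`: the function `f` acts on `H¹₀(Ω)` by `w ↦ (f, w)`. -/
def L2.toHneg1 {d : ℕ} {Ω : Set (Euc d)} (f : L2 Ω) : Hneg1 Ω :=
  (innerSL ℝ f).comp ((WithLp.fstL 2 ℝ (L2 Ω) (L2Vec Ω)).comp (H10 Ω).subtypeL)

/-- Lebesgue measure on the time interval `(0, T)`. -/
abbrev timeMeasure (T : ℝ) : Measure ℝ := volume.restrict (Ioo 0 T)

/-- `g` is the weak (distributional) time derivative of `f` on `(0, T)`, with values in the Banach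
space `X`. It is applied below only to functions in `L²(0, T; X)`. -/
def HasWeakTimeDeriv {X : Type*} [NormedAddCommGroup X] [NormedSpace ℝ X] (T : ℝ)
    (f g : ℝ → X) : Prop :=
  ∀ η : ℝ → ℝ, IsTestFunction (Ioo 0 T) η →
    ∫ t, deriv η t • f t ∂(timeMeasure T) = -∫ t, η t • g t ∂(timeMeasure T)

/-- `w(0) = w₀` for a function `w` on `(0, T) × Ω` that has a representative in `C([0, T]; L²(Ω))`:
`w(t) → w₀` in `L²(Ω)` as `t ↓ 0`, up to a null set of times. This essential limit is the value at
`0` of the continuous representative. -/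
def HasInitialValue {d : ℕ} (Ω : Set (Euc d)) (w : ℝ → Euc d → ℝ) (w₀ : Euc d → ℝ) : Prop :=
  Tendsto (fun t => eLpNorm (w t - w₀) 2 (volume.restrict Ω)) (𝓝[>] 0 ⊓ ae volume) (𝓝 0)

/-- The function `w` on `(0, T) × Ω` is measurable and is represented by the `L²(Ω)`-valued
function `W` of time. -/
def Represents {d : ℕ} (Ω : Set (Euc d)) (T : ℝ) (w : ℝ → Euc d → ℝ) (W : ℝ → L2 Ω) : Prop :=
  AEStronglyMeasurable (Function.uncurry w) ((timeMeasure T).prod (volume.restrict Ω)) ∧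
  ∀ᵐ t ∂(timeMeasure T), w t =ᵐ[volume.restrict Ω] W t

/-- Weak solutions `(u, v)` on `Q = (0, T) × Ω` of
`∂ₜ u + ∇ · F(u,v) = ∇ · [D(u,v) ∇u] + Ψ₁(u,v)`, `∂ₜ v = Ψ₂(u,v)`, with `u = 0` on `∂Ω`,
`u(0) = u₀`, `v(0) = v₀`.

Here `U` and `V` are `u` and `v` as elements of `L²(0,T;H¹₀(Ω))` and `L²(0,T;H¹(Ω))` (so
`(U t).1.snd` is `∇u(t)`), and `U' ∈ L²(0,T;H⁻¹(Ω))`, `V' ∈ L²(0,T;L²(Ω))` are their time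
derivatives. -/
def IsWeakSolution {d : ℕ} (Ω : Set (Euc d)) (T : ℝ) (D : ℝ → ℝ → ℝ) (F : ℝ → ℝ → Euc d)
    (Ψ₁ Ψ₂ : ℝ → ℝ → ℝ) (u₀ v₀ : Euc d → ℝ) (u v : ℝ → Euc d → ℝ) : Prop :=
  ∃ (U : ℝ → H10 Ω) (V : ℝ → H1 Ω) (U' : ℝ → Hneg1 Ω) (V' : ℝ → L2 Ω),
    -- `u ∈ 𝒲`
    Represents Ω T u (fun t => (U t).1.fst) ∧
    MemLp U 2 (timeMeasure T) ∧ MemLp U' 2 (timeMeasure T) ∧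
    HasWeakTimeDeriv T (fun t => L2.toHneg1 (U t).1.fst) U' ∧
    -- `v ∈ H¹(0,T;L²(Ω)) ∩ L²(0,T;H¹(Ω))`
    Represents Ω T v (fun t => (V t).1.fst) ∧
    MemLp V 2 (timeMeasure T) ∧ MemLp V' 2 (timeMeasure T) ∧
    HasWeakTimeDeriv T (fun t => (V t).1.fst) V' ∧
    -- initial conditions
    HasInitialValue Ω u u₀ ∧ HasInitialValue Ω v v₀ ∧
    -- weak form of the equation for `u`
    (∀ φ : ℝ → H10 Ω, MemLp φ 2 (timeMeasure T) →
      (∫ t, U' t (φ t) ∂(timeMeasure T))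
        + (∫ t, (∫ x in Ω, D (u t x) (v t x) * ⟪(U t).1.snd x, (φ t).1.snd x⟫) ∂(timeMeasure T))
      = (∫ t, (∫ x in Ω, ⟪F (u t x) (v t x), (φ t).1.snd x⟫) ∂(timeMeasure T))
        + (∫ t, (∫ x in Ω, Ψ₁ (u t x) (v t x) * (φ t).1.fst x) ∂(timeMeasure T))) ∧
    -- weak form of the equation for `v`
    (∀ ξ : ℝ → L2 Ω, MemLp ξ 2 (timeMeasure T) →
      ∫ t, (∫ x in Ω, V' t x * ξ t x) ∂(timeMeasure T)
      = ∫ t, (∫ x in Ω, Ψ₂ (u t x) (v t x) * ξ t x) ∂(timeMeasure T))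

end

/-!
Test the equation for `u` with `(u - u_r)⁺` and the equation for `v` with `-(v_l - v)⁺`. The
diffusion term is nonnegative, and the flux term vanishes because `F(u)` depends on `u` alone, so
that `F(u) · ∇(u - u_r)⁺` is the divergence of a field vanishing on `∂Ω`. By monotonicity and the
Lipschitz bound, the sign conditions at `(u_r, v_l)` bound both reaction terms by a constant times
`(u - u_r)⁺ (v_l - v)⁺`. Hence the energy `‖(u - u_r)⁺‖² / 2 + ‖(v_l - v)⁺‖² / 2` is at most a
constant times its primitive and vanishes by Grönwall's inequality. The other two bounds follow by
the change of unknowns `(u, v) ↦ (-u, -v)`.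

The energy inequality in time needs no product rule for weak time derivatives: the subgradient
inequality for the convex functional `w ↦ ‖(w - k)⁺‖² / 2` is integrated over difference quotients,
and translations are continuous in `L²` in time.
-/

section TestFunctions

lemma IsTestFunction.add {X : Type*} [NormedAddCommGroup X] [NormedSpace ℝ X] {Ω : Set X}
    {φ ψ : X → ℝ} (hφ : IsTestFunction Ω φ) (hψ : IsTestFunction Ω ψ) :
    IsTestFunction Ω (φ + ψ) :=
  ⟨hφ.1.add hψ.1, hφ.2.1.add hψ.2.1, (tsupport_add φ ψ).trans (union_subset hφ.2.2 hψ.2.2)⟩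

lemma IsTestFunction.const_smul {X : Type*} [NormedAddCommGroup X] [NormedSpace ℝ X] {Ω : Set X}
    {φ : X → ℝ} (hφ : IsTestFunction Ω φ) (c : ℝ) : IsTestFunction Ω (c • φ) :=
  ⟨hφ.1.const_smul c, hφ.2.1.smul_left, (tsupport_smul_subset_right (fun _ => c) φ).trans hφ.2.2⟩

lemma isTestFunction_deriv {Ω : Set ℝ} {η : ℝ → ℝ} (hη : IsTestFunction Ω η) :
    IsTestFunction Ω (deriv η) :=
  ⟨(contDiff_infty_iff_deriv.1 hη.1).2, hη.2.1.deriv, tsupport_deriv_subset.trans hη.2.2⟩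

lemma IsTestFunction.integrable {X : Type*} [NormedAddCommGroup X] [NormedSpace ℝ X]
    [MeasurableSpace X] [OpensMeasurableSpace X] {μ : Measure X} [IsFiniteMeasureOnCompacts μ]
    {Ω : Set X} {φ : X → ℝ} (hφ : IsTestFunction Ω φ) : Integrable φ μ :=
  hφ.1.continuous.integrable_of_hasCompactSupport hφ.2.1

lemma IsTestFunction.integrable_smul {X E : Type*} [NormedAddCommGroup X] [NormedSpace ℝ X]
    [MeasurableSpace X] [OpensMeasurableSpace X] [NormedAddCommGroup E] [NormedSpace ℝ E]
    {μ : Measure X} {Ω : Set X} {φ : X → ℝ} {f : X → E} (hφ : IsTestFunction Ω φ)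
    (hf : Integrable f μ) : Integrable (fun x => φ x • f x) μ := by
  obtain ⟨C, hC⟩ := hφ.2.1.exists_bound_of_continuous hφ.1.continuous
  exact hf.bdd_smul C hφ.1.continuous.aestronglyMeasurable (Eventually.of_forall hC)

lemma IsTestFunction.eq_zero_of_notMem {X : Type*} [NormedAddCommGroup X] [NormedSpace ℝ X]
    {Ω : Set X} {φ : X → ℝ} (hφ : IsTestFunction Ω φ) {x : X} (hx : x ∉ Ω) : φ x = 0 :=
  image_eq_zero_of_notMem_tsupport fun h => hx (hφ.2.2 h)

lemma exists_isTestFunction_integral_eq_one {E : Type*} [NormedAddCommGroup E] [NormedSpace ℝ E]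
    [FiniteDimensional ℝ E] [MeasurableSpace E] [BorelSpace E] (μ : Measure E)
    [IsLocallyFiniteMeasure μ] [μ.IsOpenPosMeasure] {Ω : Set E} (hΩ : IsOpen Ω)
    (hne : Ω.Nonempty) : ∃ ψ : E → ℝ, IsTestFunction Ω ψ ∧ ∫ x, ψ x ∂μ = 1 := by
  obtain ⟨x, hx⟩ := hne
  obtain ⟨r, hr, hball⟩ := Metric.isOpen_iff.1 hΩ x hx
  let b : ContDiffBump x := ⟨r / 4, r / 2, by positivity, by linarith⟩
  refine ⟨b.normed μ, ⟨b.contDiff_normed, b.hasCompactSupport_normed, ?_⟩, b.integral_normed⟩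
  rw [b.tsupport_normed_eq]
  exact (Metric.closedBall_subset_ball (half_lt_self hr)).trans hball

lemma exists_Icc_of_isCompact_subset {α : Type*} [ConditionallyCompleteLinearOrder α]
    [NoMinOrder α] [Nonempty α] [TopologicalSpace α] [OrderTopology α] {K s : Set α}
    [hs : s.OrdConnected] (hK : IsCompact K) (hKs : K ⊆ s) :
    ∃ a b, K ⊆ Icc a b ∧ Icc a b ⊆ s := by
  rcases K.eq_empty_or_nonempty with rfl | hne
  · obtain ⟨x⟩ := ‹Nonempty α›
    obtain ⟨y, hy⟩ := exists_lt x
    exact ⟨x, y, empty_subset _, by simp [hy]⟩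
  · obtain ⟨a, ha⟩ := hK.exists_isLeast hne
    obtain ⟨b, hb⟩ := hK.exists_isGreatest hne
    exact ⟨a, b, fun x hx => ⟨ha.2 hx, hb.2 hx⟩, hs.out (hKs ha.1) (hKs hb.1)⟩

lemma IsTestFunction.exists_deriv_eq {s : Set ℝ} [s.OrdConnected] {ψ : ℝ → ℝ}
    (hψ : IsTestFunction s ψ) (h0 : ∫ t, ψ t = 0) : ∃ η, IsTestFunction s η ∧ deriv η = ψ := by
  obtain ⟨a, b, hK, hs⟩ := exists_Icc_of_isCompact_subset hψ.2.1 hψ.2.2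
  have hzero : ∀ t ∉ Icc a b, ψ t = 0 := fun t ht =>
    image_eq_zero_of_notMem_tsupport fun h => ht (hK h)
  have hint : ∀ t, IntegrableOn ψ (Iic t) := fun t => hψ.integrable.integrableOn
  let η : ℝ → ℝ := fun t => ∫ s in Iic t, ψ s
  have hderiv : ∀ t, HasDerivAt η (ψ t) t := fun t => by
    have h := ((hψ.1.continuous.integral_hasStrictDerivAt 0 t).hasDerivAt).const_add (η 0)
    refine h.congr_of_eventuallyEq (Eventually.of_forall fun x => ?_)
    exact eq_add_of_sub_eq' (intervalIntegral.integral_Iic_sub_Iic (hint 0) (hint x))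
  have hsupp : tsupport η ⊆ Icc a b := by
    refine closure_minimal (fun t ht => ?_) isClosed_Icc
    by_contra hmem
    refine ht ?_
    rcases lt_or_ge t a with hta | hat
    · exact setIntegral_eq_zero_of_forall_eq_zero fun s hs =>
        hzero s fun h => (hs.trans_lt hta).not_ge h.1
    · refine (setIntegral_eq_integral_of_forall_compl_eq_zero
        fun s hs => hzero s fun h => ?_).trans h0
      exact hmem ⟨hat, (not_le.1 hs).le.trans h.2⟩
  have hη : deriv η = ψ := funext fun t => (hderiv t).deriv
  refine ⟨η, ⟨?_, isCompact_Icc.of_isClosed_subset (isClosed_tsupport η) hsupp, hsupp.trans hs⟩, hη⟩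
  exact contDiff_infty_iff_deriv.2 ⟨fun t => (hderiv t).differentiableAt, hη ▸ hψ.1⟩

end TestFunctions

section TimeInterval

variable {X : Type*} [NormedAddCommGroup X] {T : ℝ} {g : ℝ → X}

lemma intervalIntegrable_of_integrable_timeMeasure (hg : Integrable g (timeMeasure T)) {x y : ℝ}
    (hx : x ∈ Icc 0 T) (hy : y ∈ Icc 0 T) : IntervalIntegrable g volume x y :=
  (((integrableOn_Icc_iff_integrableOn_Ioo).2 hg).mono_set
    (ordConnected_Icc.uIcc_subset hx hy)).intervalIntegrable

lemma continuousOn_primitive_of_integrable_timeMeasure [NormedSpace ℝ X]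
    (hg : Integrable g (timeMeasure T)) :
    ContinuousOn (fun t => ∫ s in (0 : ℝ)..t, g s) (Icc 0 T) := by
  rcases lt_or_ge T 0 with hT | hT
  · simp [Icc_eq_empty hT.not_ge]
  · have h := intervalIntegral.continuousOn_primitive_interval (μ := volume) (a := 0) (b := T)
      (f := g) (by rw [uIcc_of_le hT]; exact (integrableOn_Icc_iff_integrableOn_Ioo).2 hg)
    rwa [uIcc_of_le hT] at h

lemma integrable_primitive_timeMeasure [NormedSpace ℝ X] (hg : Integrable g (timeMeasure T)) :
    Integrable (fun t => ∫ s in (0 : ℝ)..t, g s) (timeMeasure T) :=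
  (continuousOn_primitive_of_integrable_timeMeasure hg).integrableOn_Icc.mono_set
    Ioo_subset_Icc_self

lemma integral_timeMeasure_eq [NormedSpace ℝ X] (hT : 0 ≤ T) (f : ℝ → X) :
    ∫ t, f t ∂(timeMeasure T) = ∫ t in (0 : ℝ)..T, f t := by
  rw [intervalIntegral.integral_of_le hT, integral_Ioc_eq_integral_Ioo]

end TimeInterval

section WeakTimeDeriv

variable {X : Type*} [NormedAddCommGroup X] [NormedSpace ℝ X] {T : ℝ} {f₁ f₂ g₁ g₂ f g : ℝ → X}

lemma HasWeakTimeDeriv.sub (h₁ : HasWeakTimeDeriv T f₁ g₁) (h₂ : HasWeakTimeDeriv T f₂ g₂)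
    (hf₁ : Integrable f₁ (timeMeasure T)) (hf₂ : Integrable f₂ (timeMeasure T))
    (hg₁ : Integrable g₁ (timeMeasure T)) (hg₂ : Integrable g₂ (timeMeasure T)) :
    HasWeakTimeDeriv T (f₁ - f₂) (g₁ - g₂) := by
  intro η hη
  have hη' := isTestFunction_deriv hη
  simp only [Pi.sub_apply, smul_sub]
  rw [integral_sub (hη'.integrable_smul hf₁) (hη'.integrable_smul hf₂),
    integral_sub (hη.integrable_smul hg₁) (hη.integrable_smul hg₂), h₁ η hη, h₂ η hη]
  abel

lemma hasWeakTimeDeriv_primitive_real (hT : 0 ≤ T) {g : ℝ → ℝ}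
    (hg : Integrable g (timeMeasure T)) :
    HasWeakTimeDeriv T (fun t => ∫ s in (0 : ℝ)..t, g s) g := by
  intro η hη
  have hgi := intervalIntegrable_of_integrable_timeMeasure hg (left_mem_Icc.2 hT)
    (right_mem_Icc.2 hT)
  have hparts := AbsolutelyContinuousOnInterval.integral_mul_deriv_eq_deriv_mul
    (hgi.absolutelyContinuousOnInterval_intervalIntegral left_mem_uIcc)
    ((hη.1.of_le (by simp)).contDiffOn.absolutelyContinuousOnInterval (a := 0) (b := T))
  have hderiv : ∫ t in (0 : ℝ)..T, deriv (fun t => ∫ s in (0 : ℝ)..t, g s) t * η t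
      = ∫ t in (0 : ℝ)..T, η t * g t := by
    refine intervalIntegral.integral_congr_ae ?_
    filter_upwards [hgi.ae_hasDerivAt_integral] with t ht hmem
    rw [(ht (uIoc_subset_uIcc hmem) 0 left_mem_uIcc).deriv, mul_comm]
  rw [hη.eq_zero_of_notMem (x := T) (by simp), intervalIntegral.integral_same, hderiv] at hparts
  simpa [integral_timeMeasure_eq hT, mul_comm] using hparts

/-- Duality reduces the claim to real functions, where integration by parts for absolutely
continuous functions is available. -/
lemma hasWeakTimeDeriv_primitive [CompleteSpace X] (hT : 0 ≤ T)
    (hg : Integrable g (timeMeasure T)) :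
    HasWeakTimeDeriv T (fun t => ∫ s in (0 : ℝ)..t, g s) g := by
  intro η hη
  refine SeparatingDual.eq_iff_forall_dual_eq (R := ℝ) |>.2 fun ℓ => ?_
  have hprim : ∀ t ∈ Ioo 0 T, ℓ (∫ s in (0 : ℝ)..t, g s) = ∫ s in (0 : ℝ)..t, ℓ (g s) := fun t ht =>
    (ℓ.intervalIntegral_comp_comm (intervalIntegrable_of_integrable_timeMeasure hg
      (left_mem_Icc.2 hT) (Ioo_subset_Icc_self ht))).symm
  rw [map_neg,
    ← ℓ.integral_comp_comm ((isTestFunction_deriv hη).integrable_smul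
      (integrable_primitive_timeMeasure hg)), ← ℓ.integral_comp_comm (hη.integrable_smul hg)]
  simp only [map_smul]
  rw [← hasWeakTimeDeriv_primitive_real hT (ℓ.integrable_comp hg) η hη]
  exact setIntegral_congr_fun measurableSet_Ioo fun t ht => by simp only [hprim t ht]

lemma IsTestFunction.setIntegral_smul {E : Type*} [NormedAddCommGroup E] [NormedSpace ℝ E]
    [MeasurableSpace E] {μ : Measure E} {Ω : Set E} {φ : E → ℝ} (hφ : IsTestFunction Ω φ)
    (f : E → X) : ∫ x in Ω, φ x • f x ∂μ = ∫ x, φ x • f x ∂μ :=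
  setIntegral_eq_integral_of_forall_compl_eq_zero fun x hx => by
    rw [hφ.eq_zero_of_notMem hx, zero_smul]

theorem HasWeakTimeDeriv.exists_ae_eq_const [CompleteSpace X] (h : HasWeakTimeDeriv T f 0)
    (hT : 0 < T) (hf : Integrable f (timeMeasure T)) :
    ∃ c, ∀ᵐ t ∂(timeMeasure T), f t = c := by
  obtain ⟨ψ₀, hψ₀, hψ₀_one⟩ :=
    exists_isTestFunction_integral_eq_one volume isOpen_Ioo (nonempty_Ioo.2 hT)
  have hzero : ∀ ψ, IsTestFunction (Ioo 0 T) ψ → ∫ t, ψ t = 0 →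
      ∫ t, ψ t • f t ∂(timeMeasure T) = 0 := by
    intro ψ hψ h0
    obtain ⟨η, hη, rfl⟩ := hψ.exists_deriv_eq h0
    simpa using h η hη
  set c : X := ∫ t, ψ₀ t • f t ∂(timeMeasure T) with hc
  have hfc : Integrable (fun t => f t - c) (timeMeasure T) := hf.sub (integrable_const c)
  have hae : ∀ᵐ t, t ∈ Ioo 0 T → f t - c = 0 := by
    refine isOpen_Ioo.ae_eq_zero_of_integral_contDiff_smul_eq_zero
      (IntegrableOn.locallyIntegrableOn hfc) fun ψ hψ_smooth hψ_compact hψ_supp => ?_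
    have hψ : IsTestFunction (Ioo 0 T) ψ := ⟨hψ_smooth, hψ_compact, hψ_supp⟩
    -- `ψ - (∫ ψ) ψ₀` has zero integral, hence is a derivative
    have hortho := hzero _ (hψ.add (hψ₀.const_smul (-∫ t, ψ t))) (by
      simp only [Pi.add_apply, Pi.smul_apply, smul_eq_mul]
      rw [integral_add hψ.integrable (hψ₀.integrable.const_mul _), integral_const_mul, hψ₀_one]
      ring)
    have hmass : ∫ t, ψ t • c ∂(timeMeasure T) = (∫ t, ψ t) • c := by
      rw [hψ.setIntegral_smul, integral_smul_const]
    simp only [Pi.add_apply, Pi.smul_apply, add_smul, smul_assoc] at hortho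
    have hψ₀f : Integrable (fun t => (-∫ t, ψ t) • ψ₀ t • f t) (timeMeasure T) :=
      (hψ₀.integrable_smul hf).smul _
    rw [integral_add (hψ.integrable_smul hf) hψ₀f, integral_smul, ← hc, neg_smul] at hortho
    rw [← hψ.setIntegral_smul]
    simp only [smul_sub]
    rw [integral_sub (hψ.integrable_smul hf) (hψ.integrable_smul (integrable_const c)), hmass,
      sub_eq_add_neg, hortho]
  refine ⟨c, (ae_restrict_iff' measurableSet_Ioo).2 ?_⟩
  filter_upwards [hae] with t ht hmem using sub_eq_zero.1 (ht hmem)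

theorem HasWeakTimeDeriv.exists_ae_eq_primitive [CompleteSpace X] (h : HasWeakTimeDeriv T f g)
    (hT : 0 < T) (hf : Integrable f (timeMeasure T)) (hg : Integrable g (timeMeasure T)) :
    ∃ c, ∀ᵐ t ∂(timeMeasure T), f t = c + ∫ s in (0 : ℝ)..t, g s := by
  have hdiff := h.sub (hasWeakTimeDeriv_primitive hT.le hg) hf
    (integrable_primitive_timeMeasure hg) hg hg
  rw [sub_self] at hdiff
  obtain ⟨c, hc⟩ := hdiff.exists_ae_eq_const hT (hf.sub (integrable_primitive_timeMeasure hg))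
  exact ⟨c, hc.mono fun t ht => sub_eq_iff_eq_add.1 ht⟩

end WeakTimeDeriv

section Translation

variable {Y : Type*} [NormedAddCommGroup Y] [NormedSpace ℝ Y] {p q : ℝ≥0∞} [p.HolderConjugate q]

lemma memLp_indicator_of_subset {α E : Type*} [MeasurableSpace α] [NormedAddCommGroup E]
    {μ : Measure α} {s t : Set α} {f : α → E} {p : ℝ≥0∞} (hs : MeasurableSet s) (hst : s ⊆ t)
    (hf : MemLp f p (μ.restrict t)) : MemLp (s.indicator f) p μ :=
  (memLp_indicator_iff_restrict hs).2 (hf.mono_measure (Measure.restrict_mono_set μ hst))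

lemma integrable_clm_apply {α : Type*} [MeasurableSpace α] {μ : Measure α} {g : α → Y →L[ℝ] ℝ}
    {φ : α → Y} (hg : MemLp g p μ) (hφ : MemLp φ q μ) : Integrable (fun t => g t (φ t)) μ :=
  memLp_one_iff_integrable.1 ((ContinuousLinearMap.id ℝ (Y →L[ℝ] ℝ)).memLp_of_bilin 1 hg hφ)

variable {g : ℝ → Y →L[ℝ] ℝ} {φ : ℝ → Y}

lemma continuous_integral_translate (hp : p ≠ ⊤) (hg : MemLp g p) (hφ : MemLp φ q) :
    Continuous fun σ : ℝ => ∫ t, g (t - σ) (φ t) := by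
  have : Fact (1 ≤ p) := ⟨ENNReal.HolderConjugate.one_le p q⟩
  have : Fact (1 ≤ q) := ⟨ENNReal.HolderConjugate.one_le q p⟩
  have hmp : ∀ σ : ℝ, MeasurePreserving (fun t : ℝ => t - σ) volume volume := fun σ =>
    measurePreserving_sub_right volume σ
  let translate : C(ℝ, C(ℝ, ℝ)) :=
    (ContinuousMap.mk (fun a : ℝ × ℝ => a.2 - a.1) (by fun_prop)).curry
  have hLp : Continuous fun σ => Lp.compMeasurePreserving (translate σ) (hmp σ) (hg.toLp g) :=
    continuous_const.compMeasurePreservingLp translate.continuous hmp hp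
  let pairing := ContinuousLinearMap.lpPairing (volume : Measure ℝ) p q
    (ContinuousLinearMap.id ℝ (Y →L[ℝ] ℝ))
  refine ((pairing.continuous.comp hLp).clm_apply (continuous_const (y := hφ.toLp φ))).congr
    fun σ => (ContinuousLinearMap.lpPairing_eq_integral _ _ _).trans (integral_congr_ae ?_)
  filter_upwards [Lp.coeFn_compMeasurePreserving (hg.toLp g) (hmp σ), hφ.coeFn_toLp,
    (hmp σ).quasiMeasurePreserving.ae hg.coeFn_toLp] with t hcomp hφt hgt
  rw [hφt]
  exact congrArg (fun l : Y →L[ℝ] ℝ => l (φ t)) (hcomp.trans hgt)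

lemma integrable_prod_translate (hg : MemLp g p) (hφ : MemLp φ q) (a b : ℝ) :
    Integrable (Function.uncurry fun σ t : ℝ => g (t - σ) (φ t))
      ((volume.restrict (uIoc a b)).prod volume) := by
  have : IsFiniteMeasure (volume.restrict (uIoc a b)) := by
    rw [uIoc]
    infer_instance
  exact integrable_clm_apply (p := p) (q := q)
    ((hg.comp_snd _).comp_measurePreserving (measurePreserving_prod_sub _ volume)) (hφ.comp_snd _)

lemma increment_apply_eq (hg : LocallyIntegrable g) (h t : ℝ) (y : Y) :
    (∫ s in (t - h)..t, g s) y = ∫ σ in (0 : ℝ)..h, g (t - σ) y := by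
  have hgi : IntervalIntegrable g volume (t - h) t :=
    (hg.integrableOn_isCompact isCompact_uIcc).intervalIntegrable
  rw [ContinuousLinearMap.intervalIntegral_apply hgi,
    intervalIntegral.integral_comp_sub_left (fun s => g s y) t, sub_zero]

lemma integrable_increment_apply (hg : MemLp g p) (hφ : MemLp φ q) (h : ℝ) :
    Integrable fun t => (∫ s in (t - h)..t, g s) (φ t) := by
  have hgi := hg.locallyIntegrable (ENNReal.HolderConjugate.one_le p q)
  simp only [increment_apply_eq hgi]
  simp only [intervalIntegral.intervalIntegral_eq_integral_uIoc]
  exact (integrable_prod_translate hg hφ 0 h).integral_prod_right.smul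
    (if 0 ≤ h then (1 : ℝ) else -1)

lemma integral_increment_apply_eq (hg : MemLp g p) (hφ : MemLp φ q) (h : ℝ) :
    ∫ t, (∫ s in (t - h)..t, g s) (φ t) = ∫ σ in (0 : ℝ)..h, ∫ t, g (t - σ) (φ t) := by
  simp only [increment_apply_eq (hg.locallyIntegrable (ENNReal.HolderConjugate.one_le p q))]
  exact (intervalIntegral_integral_swap (integrable_prod_translate hg hφ 0 h)).symm

lemma hasDerivAt_integral_increment_apply (hp : p ≠ ⊤) (hg : MemLp g p) (hφ : MemLp φ q) :
    HasDerivAt (fun h => ∫ t, (∫ s in (t - h)..t, g s) (φ t)) (∫ t, g t (φ t)) 0 := by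
  simp only [integral_increment_apply_eq hg hφ]
  simpa using ((continuous_integral_translate hp hg hφ).integral_hasStrictDerivAt 0 0).hasDerivAt

end Translation

lemma hasDerivAt_integral_sub_translate {E : Type*} [NormedAddCommGroup E] [NormedSpace ℝ E]
    {f : ℝ → E} (hf : Integrable f) {a b : ℝ}
    (ha : HasDerivAt (fun x => ∫ t in (0 : ℝ)..x, f t) (f a) a)
    (hb : HasDerivAt (fun x => ∫ t in (0 : ℝ)..x, f t) (f b) b) :
    HasDerivAt (fun h => ∫ t in a..b, (f t - f (t - h))) (f b - f a) 0 := by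
  have hfi : ∀ x y, IntervalIntegrable f volume x y := fun x y => hf.intervalIntegrable
  have heq : ∀ h, ∫ t in a..b, (f t - f (t - h)) = (∫ t in a..b, f t)
      - ((∫ t in (0 : ℝ)..(b - h), f t) - ∫ t in (0 : ℝ)..(a - h), f t) := fun h => by
    rw [intervalIntegral.integral_sub (hfi a b) (hf.comp_sub_right h).intervalIntegrable,
      intervalIntegral.integral_comp_sub_right,
      intervalIntegral.integral_interval_sub_left (hfi _ _) (hfi _ _)]
  have hshift : ∀ x, HasDerivAt (fun x => ∫ t in (0 : ℝ)..x, f t) (f x) x →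
      HasDerivAt (fun h => ∫ t in (0 : ℝ)..(x - h), f t) (-f x) 0 := fun x hx =>
    HasDerivAt.comp_const_sub x 0 (by rwa [sub_zero])
  simp only [heq]
  convert! ((hshift b hb).sub (hshift a ha)).const_sub (∫ t in a..b, f t) using 1
  abel

lemma le_of_hasDerivAt_of_eventually_le {F G : ℝ → ℝ} {F' G' a : ℝ} (hF : HasDerivAt F F' a)
    (hG : HasDerivAt G G' a) (heq : F a = G a) (hle : ∀ᶠ x in 𝓝[>] a, F x ≤ G x) : F' ≤ G' := by
  have hslope := (hasDerivWithinAt_iff_tendsto_slope' self_notMem_Ioi).1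
    ((hG.sub hF).hasDerivWithinAt (s := Ioi a))
  refine sub_nonneg.1 (ge_of_tendsto hslope ?_)
  filter_upwards [hle, self_mem_nhdsWithin] with x hx hax
  rw [slope_def_field, Pi.sub_apply, Pi.sub_apply, heq, sub_self, sub_zero]
  exact div_nonneg (sub_nonneg.2 hx) (sub_nonneg.2 (le_of_lt hax))

instance nhdsGT_inf_ae_neBot (a : ℝ) : (𝓝[>] a ⊓ ae (volume : Measure ℝ)).NeBot := by
  refine Filter.inf_neBot_iff.2 fun s hs t ht => ?_
  obtain ⟨b, hb, hbs⟩ := mem_nhdsGT_iff_exists_Ioo_subset.1 hs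
  have hpos : volume (Ioo a b ∩ t) ≠ 0 := by
    rw [measure_inter_conull ht]
    simpa using hb
  exact (nonempty_of_measure_ne_zero hpos).mono (inter_subset_inter_left t hbs)

section Energy

variable {Y : Type*} [NormedAddCommGroup Y] [NormedSpace ℝ Y] {p q : ℝ≥0∞} [p.HolderConjugate q]
  {T : ℝ} {W U' : ℝ → Y →L[ℝ] ℝ} {φ : ℝ → Y} {f : ℝ → ℝ}

lemma ae_sub_translate_eq_integral {X : Type*} [NormedAddCommGroup X] [NormedSpace ℝ X]
    {f g : ℝ → X} {c : X} (hg : Integrable g (timeMeasure T))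
    (hf : ∀ᵐ t ∂(timeMeasure T), f t = c + ∫ s in (0 : ℝ)..t, g s) (h : ℝ) :
    ∀ᵐ t, t ∈ Ioo 0 T → t - h ∈ Ioo 0 T → f t - f (t - h) = ∫ s in (t - h)..t, g s := by
  have hf' := (ae_restrict_iff' measurableSet_Ioo).1 hf
  filter_upwards [hf', (measurePreserving_sub_right volume h).quasiMeasurePreserving.ae hf']
    with t ht hth hmem hmemh
  have h0 : (0 : ℝ) ∈ Icc 0 T := left_mem_Icc.2 (hmem.1.trans hmem.2).le
  rw [ht hmem, hth hmemh, add_sub_add_left_eq_sub, intervalIntegral.integral_interval_sub_left] <;>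
  exact intervalIntegrable_of_integrable_timeMeasure hg h0 (Ioo_subset_Icc_self ‹_›)

/-- The subgradient inequality, integrated over the time steps `(t - h, t)` for `t ∈ (a, b)`. -/
lemma integral_sub_translate_le (hU' : MemLp U' p (timeMeasure T))
    (hφ : MemLp φ q (timeMeasure T)) (hf : Integrable f (timeMeasure T)) {c : Y →L[ℝ] ℝ}
    (hW : ∀ᵐ t ∂(timeMeasure T), W t = c + ∫ s in (0 : ℝ)..t, U' s)
    (hsub : ∀ s t, f t - f s ≤ (W t - W s) (φ t)) {a b h : ℝ} (hab : a ≤ b) (hb : b < T)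
    (hh : h ∈ Ioo 0 a) :
    ∫ t in a..b, ((Ioo 0 T).indicator f t - (Ioo 0 T).indicator f (t - h))
      ≤ ∫ t, (∫ s in (t - h)..t, (Ioo 0 T).indicator U' s) ((Ioc a b).indicator φ t) := by
  have hU'e : MemLp ((Ioo 0 T).indicator U') p :=
    memLp_indicator_of_subset measurableSet_Ioo Subset.rfl hU'
  have hfe : Integrable ((Ioo 0 T).indicator f) := (integrable_indicator_iff measurableSet_Ioo).2 hf
  have hsubset : Ioc a b ⊆ Ioo 0 T := fun t ht => ⟨(hh.1.trans hh.2).trans ht.1, ht.2.trans_lt hb⟩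
  have hφe : MemLp ((Ioc a b).indicator φ) q :=
    memLp_indicator_of_subset measurableSet_Ioc hsubset hφ
  have hint := integrable_increment_apply hU'e hφe h
  have hzero : ∀ t ∉ Ioc a b,
      (∫ s in (t - h)..t, (Ioo 0 T).indicator U' s) ((Ioc a b).indicator φ t) = 0 := fun t ht => by
    rw [indicator_of_notMem ht, map_zero]
  rw [intervalIntegral.integral_of_le hab, ← setIntegral_eq_integral_of_forall_compl_eq_zero hzero]
  refine setIntegral_mono_on_ae (hfe.sub (hfe.comp_sub_right h)).integrableOn hint.integrableOn
    measurableSet_Ioc ?_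
  have hp : 1 ≤ p := ENNReal.HolderConjugate.one_le p q
  filter_upwards [ae_sub_translate_eq_integral (hU'.integrable hp) hW h] with t ht hmem
  have htT := hsubset hmem
  have hthT : t - h ∈ Ioo 0 T :=
    ⟨sub_pos.2 (hh.2.trans hmem.1), (sub_lt_self t hh.1).trans htT.2⟩
  have hincr : ∫ s in (t - h)..t, (Ioo 0 T).indicator U' s = ∫ s in (t - h)..t, U' s :=
    intervalIntegral.integral_congr fun s hs =>
      indicator_of_mem (ordConnected_Ioo.uIcc_subset hthT htT hs) U'
  rw [indicator_of_mem htT, indicator_of_mem hthT, indicator_of_mem hmem, hincr, ← ht htT hthT]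
  exact hsub _ _

/-- Both sides of `integral_sub_translate_le` vanish at `h = 0`; compare their derivatives there. -/
lemma sub_le_integral_of_hasDerivAt_primitive (hp : p ≠ ⊤) (hU' : MemLp U' p (timeMeasure T))
    (hφ : MemLp φ q (timeMeasure T)) (hf : Integrable f (timeMeasure T)) {c : Y →L[ℝ] ℝ}
    (hW : ∀ᵐ t ∂(timeMeasure T), W t = c + ∫ s in (0 : ℝ)..t, U' s)
    (hsub : ∀ s t, f t - f s ≤ (W t - W s) (φ t)) {a b : ℝ} (ha : a ∈ Ioo 0 T) (hb : b ∈ Ioo a T)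
    (hfa : HasDerivAt (fun x => ∫ t in (0 : ℝ)..x, (Ioo 0 T).indicator f t)
      ((Ioo 0 T).indicator f a) a)
    (hfb : HasDerivAt (fun x => ∫ t in (0 : ℝ)..x, (Ioo 0 T).indicator f t)
      ((Ioo 0 T).indicator f b) b) :
    f b - f a ≤ ∫ t in a..b, U' t (φ t) := by
  have hU'e : MemLp ((Ioo 0 T).indicator U') p :=
    memLp_indicator_of_subset measurableSet_Ioo Subset.rfl hU'
  have hbT : b ∈ Ioo 0 T := ⟨ha.1.trans hb.1, hb.2⟩
  have hsubset : Ioc a b ⊆ Ioo 0 T := fun t ht => ⟨ha.1.trans ht.1, ht.2.trans_lt hb.2⟩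
  have hφe : MemLp ((Ioc a b).indicator φ) q :=
    memLp_indicator_of_subset measurableSet_Ioc hsubset hφ
  have hle := le_of_hasDerivAt_of_eventually_le
    (hasDerivAt_integral_sub_translate ((integrable_indicator_iff measurableSet_Ioo).2 hf) hfa hfb)
    (hasDerivAt_integral_increment_apply hp hU'e hφe) (by simp) (by
      filter_upwards [Ioo_mem_nhdsGT ha.1] with h hh
      exact integral_sub_translate_le hU' hφ hf hW hsub hb.1.le hb.2 hh)
  rw [indicator_of_mem ha, indicator_of_mem hbT] at hle
  refine hle.trans_eq ?_
  rw [intervalIntegral.integral_of_le hb.1.le, ← integral_indicator measurableSet_Ioc]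
  congr 1 with t
  by_cases ht : t ∈ Ioc a b
  · rw [indicator_of_mem ht, indicator_of_mem ht, indicator_of_mem (hsubset ht)]
  · rw [indicator_of_notMem ht, indicator_of_notMem ht, map_zero]

theorem HasWeakTimeDeriv.ae_le_integral (hU : HasWeakTimeDeriv T W U') (hT : 0 < T) (hp : p ≠ ⊤)
    (hW : Integrable W (timeMeasure T)) (hU' : MemLp U' p (timeMeasure T))
    (hφ : MemLp φ q (timeMeasure T)) (hf : Integrable f (timeMeasure T))
    (hsub : ∀ s t, f t - f s ≤ (W t - W s) (φ t))
    (hf0 : Tendsto f (𝓝[>] 0 ⊓ ae volume) (𝓝 0)) :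
    ∀ᵐ s ∂(timeMeasure T), f s ≤ ∫ t in (0 : ℝ)..s, U' t (φ t) := by
  have hint : Integrable (fun t => U' t (φ t)) (timeMeasure T) := integrable_clm_apply hU' hφ
  obtain ⟨c, hc⟩ := hU.exists_ae_eq_primitive hT hW
    (hU'.integrable (ENNReal.HolderConjugate.one_le p q))
  have hleb := LocallyIntegrable.ae_hasDerivAt_integral
    ((integrable_indicator_iff measurableSet_Ioo).2 hf).locallyIntegrable
  filter_upwards [ae_restrict_of_ae hleb, ae_restrict_mem measurableSet_Ioo] with b hb hbT
  have h0T : (0 : ℝ) ∈ Icc 0 T := left_mem_Icc.2 hT.le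
  have hright : Tendsto (fun a => (∫ t in (0 : ℝ)..b, U' t (φ t)) - ∫ t in (0 : ℝ)..a, U' t (φ t))
      (𝓝[>] 0 ⊓ ae volume) (𝓝 (∫ t in (0 : ℝ)..b, U' t (φ t))) := by
    have hcont := continuousOn_primitive_of_integrable_timeMeasure hint 0 h0T
    have h := (hcont.tendsto.mono_left
      (nhdsWithin_le_of_mem (Icc_mem_nhdsGT hT))).const_sub (∫ t in (0 : ℝ)..b, U' t (φ t))
    rw [intervalIntegral.integral_same, sub_zero] at h
    exact h.mono_left inf_le_left
  have hlim := le_of_tendsto_of_tendsto (hf0.const_sub (f b)) hright ?_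
  · rwa [sub_zero] at hlim
  filter_upwards [mem_inf_of_left (Ioo_mem_nhdsGT hbT.1), mem_inf_of_right hleb] with a hab ha
  have haT : a ∈ Ioo 0 T := ⟨hab.1, hab.2.trans hbT.2⟩
  rw [intervalIntegral.integral_interval_sub_left
    (intervalIntegrable_of_integrable_timeMeasure hint h0T (Ioo_subset_Icc_self hbT))
    (intervalIntegrable_of_integrable_timeMeasure hint h0T (Ioo_subset_Icc_self haT))]
  exact sub_le_integral_of_hasDerivAt_primitive hp hU' hφ hf hc hsub haT ⟨hab.2, hbT.2⟩
    (ha 0) (hb 0)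

end Energy

section Gronwall

variable {T C : ℝ} {y : ℝ → ℝ}

lemma hasDerivWithinAt_primitive_Ici (hy : ContinuousOn y (Icc 0 T)) {s : ℝ} (hs : s ∈ Ico 0 T) :
    HasDerivWithinAt (fun s => ∫ t in (0 : ℝ)..s, y t) (y s) (Ici s) s := by
  have hmem : Icc 0 T ∈ 𝓝[≥] s :=
    mem_of_superset (Icc_mem_nhdsGE hs.2) (Icc_subset_Icc_left hs.1)
  have hint : IntervalIntegrable y volume 0 s := ContinuousOn.intervalIntegrable
    (hy.mono (by rw [uIcc_of_le hs.1]; exact Icc_subset_Icc_right hs.2.le))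
  exact intervalIntegral.integral_hasDerivWithinAt_right hint (t := Ioi s)
    ⟨Icc 0 T, nhdsWithin_mono _ Ioi_subset_Ici_self hmem,
      hy.aestronglyMeasurable measurableSet_Icc⟩
    ((hy s ⟨hs.1, hs.2.le⟩).mono_of_mem_nhdsWithin (nhdsWithin_mono _ Ioi_subset_Ici_self hmem))

lemma eq_zero_of_le_mul_primitive (hy : ContinuousOn y (Icc 0 T)) (h0 : ∀ t ∈ Ico 0 T, 0 ≤ y t)
    (hle : ∀ t ∈ Ico 0 T, y t ≤ C * ∫ s in (0 : ℝ)..t, y s) : ∀ t ∈ Ico 0 T, y t = 0 := by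
  intro t ht
  have hnonneg : ∀ s ∈ Ico 0 T, 0 ≤ ∫ r in (0 : ℝ)..s, y r := fun s hs =>
    intervalIntegral.integral_nonneg hs.1 fun r hr => h0 r ⟨hr.1, hr.2.trans_lt hs.2⟩
  have hbound := norm_le_gronwallBound_of_norm_deriv_right_le (δ := 0) (K := C) (ε := 0)
    (continuousOn_primitive_of_integrable_timeMeasure
      (hy.integrableOn_Icc.mono_set Ioo_subset_Icc_self))
    (fun s hs => hasDerivWithinAt_primitive_Ici hy hs) (by simp) (fun s hs => by
      rw [Real.norm_of_nonneg (h0 s hs), Real.norm_of_nonneg (hnonneg s hs), add_zero]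
      exact hle s hs) t (Ico_subset_Icc_self ht)
  rw [gronwallBound_ε0, zero_mul, norm_le_zero_iff] at hbound
  exact le_antisymm ((hle t ht).trans_eq (by rw [hbound, mul_zero])) (h0 t ht)

theorem ae_eq_zero_of_ae_le_mul_primitive (hy : Integrable y (timeMeasure T)) (h0 : ∀ t, 0 ≤ y t)
    (hle : ∀ᵐ t ∂(timeMeasure T), y t ≤ C * ∫ s in (0 : ℝ)..t, y s) :
    ∀ᵐ t ∂(timeMeasure T), y t = 0 := by
  have hcont := continuousOn_primitive_of_integrable_timeMeasure hy
  have hprim : ∀ t ∈ Ico 0 T, ∫ s in (0 : ℝ)..t, y s = 0 := by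
    refine eq_zero_of_le_mul_primitive (C := C) hcont
      (fun t ht => intervalIntegral.integral_nonneg ht.1 fun s _ => h0 s) fun t ht => ?_
    have h0T : (0 : ℝ) ∈ Icc 0 T := left_mem_Icc.2 (ht.1.trans ht.2.le)
    rw [← intervalIntegral.integral_const_mul]
    refine intervalIntegral.integral_mono_ae_restrict ht.1
      (intervalIntegrable_of_integrable_timeMeasure hy h0T (Ico_subset_Icc_self ht))
      ((intervalIntegrable_of_integrable_timeMeasure (integrable_primitive_timeMeasure hy) h0T
        (Ico_subset_Icc_self ht)).const_mul C) ?_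
    rw [← restrict_Ioo_eq_restrict_Icc]
    exact ae_restrict_of_ae_restrict_of_subset (Ioo_subset_Ioo_right ht.2.le) hle
  filter_upwards [hle, ae_restrict_mem measurableSet_Ioo] with t ht hmem
  rw [hprim t (Ioo_subset_Ico_self hmem), mul_zero] at ht
  exact le_antisymm ht (h0 t)

end Gronwall

section Dominated

variable {α E F : Type*} [MeasurableSpace α] {μ : Measure α} [NormedAddCommGroup E]
  [NormedAddCommGroup F] {p : ℝ≥0∞} [Fact (1 ≤ p)]

theorem tendsto_Lp_of_dominated (hp : p ≠ ⊤) {f : ℕ → Lp E p μ} {f₀ : Lp E p μ} (g : Lp F p μ)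
    (hb : ∀ n, ∀ᵐ x ∂μ, ‖f n x‖ ≤ ‖g x‖)
    (hlim : ∀ᵐ x ∂μ, Tendsto (fun n => f n x) atTop (𝓝 (f₀ x))) :
    Tendsto f atTop (𝓝 f₀) := by
  have hle : ∀ n (s : Set α), eLpNorm (s.indicator (f n)) p μ ≤ eLpNorm (s.indicator g) p μ := by
    refine fun n s => eLpNorm_mono_ae ?_
    filter_upwards [hb n] with x hx
    rw [norm_indicator_eq_indicator_norm, norm_indicator_eq_indicator_norm]
    exact indicator_le_indicator hx
  have h1p : 1 ≤ p := Fact.out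
  refine (Lp.tendsto_Lp_iff_tendsto_eLpNorm' _ _).2 (tendsto_Lp_of_tendsto_ae h1p hp
    (fun n => Lp.aestronglyMeasurable (f n)) (Lp.memLp f₀) (fun ε hε => ?_) (fun ε hε => ?_) hlim)
  · obtain ⟨δ, hδ, h⟩ := unifIntegrable_const (ι := Unit) h1p hp (Lp.memLp g) hε
    exact ⟨δ, hδ, fun n s hs hμs => (hle n s).trans (h () s hs hμs)⟩
  · obtain ⟨s, hs, h⟩ := unifTight_const (ι := Unit) hp (Lp.memLp g) hε
    exact ⟨s, hs, fun n => (hle n sᶜ).trans (h ())⟩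

end Dominated

section CompSmul

variable {α X E : Type*} [NormedAddCommGroup E] [NormedSpace ℝ E] {b : X → ℝ} {C : ℝ}

lemma norm_smul_le_norm_const_smul (hC : ∀ s, |b s| ≤ C) (s : X) (y : E) :
    ‖b s • y‖ ≤ ‖C • y‖ := by
  rw [norm_smul, norm_smul]
  exact mul_le_mul_of_nonneg_right ((hC s).trans (le_abs_self C)) (norm_nonneg y)

variable [MeasurableSpace α] {μ : Measure α} [NormedAddCommGroup X] [MeasurableSpace X]
  [BorelSpace X] {p q : ℝ≥0∞}

lemma memLp_comp_smul (hb : Measurable b) (hC : ∀ s, |b s| ≤ C) (f : Lp X p μ) (g : Lp E q μ) :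
    MemLp (fun x => b (f x) • g x) q μ := by
  have hbf : AEStronglyMeasurable (fun x => b (f x)) μ :=
    (hb.comp_aemeasurable (Lp.aestronglyMeasurable f).aemeasurable).aestronglyMeasurable
  exact ((Lp.memLp g).const_smul C).mono (hbf.smul (Lp.aestronglyMeasurable g))
    (Eventually.of_forall fun x => norm_smul_le_norm_const_smul hC (f x) (g x))

/-- The product `b(f) g ∈ L^q` of `g ∈ L^q` with the bounded coefficient `b(f)`. -/
noncomputable def compSmul (hb : Measurable b) (hC : ∀ s, |b s| ≤ C) (f : Lp X p μ)
    (g : Lp E q μ) : Lp E q μ :=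
  (memLp_comp_smul hb hC f g).toLp _

lemma coeFn_compSmul (hb : Measurable b) (hC : ∀ s, |b s| ≤ C) (f : Lp X p μ) (g : Lp E q μ) :
    compSmul hb hC f g =ᵐ[μ] fun x => b (f x) • g x :=
  (memLp_comp_smul hb hC f g).coeFn_toLp

lemma norm_compSmul_sub_le (hb : Measurable b) (hC : ∀ s, |b s| ≤ C) (f : Lp X p μ)
    (g₁ g₂ : Lp E q μ) : ‖compSmul hb hC f g₁ - compSmul hb hC f g₂‖ ≤ C * ‖g₁ - g₂‖ := by
  refine Lp.norm_le_mul_norm_of_ae_le_mul ?_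
  filter_upwards [coeFn_compSmul hb hC f g₁, coeFn_compSmul hb hC f g₂, Lp.coeFn_sub g₁ g₂,
    Lp.coeFn_sub (compSmul hb hC f g₁) (compSmul hb hC f g₂)] with x h₁ h₂ hg hfg
  rw [hfg, hg, Pi.sub_apply, Pi.sub_apply, h₁, h₂, ← smul_sub, norm_smul]
  exact mul_le_mul_of_nonneg_right (hC _) (norm_nonneg _)

variable [Fact (1 ≤ p)] [Fact (1 ≤ q)]

lemma continuous_compSmul_left (hq : q ≠ ⊤) (hb : Continuous b) (hC : ∀ s, |b s| ≤ C)
    (g : Lp E q μ) : Continuous fun f : Lp X p μ => compSmul hb.measurable hC f g := by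
  refine continuous_iff_seqContinuous.2 fun f f₀ hf => ?_
  refine tendsto_of_subseq_tendsto fun ns hns => ?_
  obtain ⟨ms, -, hae⟩ := (tendstoInMeasure_of_tendsto_Lp (hf.comp hns)).exists_seq_tendsto_ae
  refine ⟨ms, tendsto_Lp_of_dominated hq (C • g) (fun n => ?_) ?_⟩
  · filter_upwards [coeFn_compSmul hb.measurable hC (f (ns (ms n))) g, Lp.coeFn_smul C g]
      with x hx hCg
    rw [Function.comp_apply, hx, hCg]
    exact norm_smul_le_norm_const_smul hC _ _
  · filter_upwards [ae_all_iff.2 fun n => coeFn_compSmul hb.measurable hC (f (ns (ms n))) g,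
      coeFn_compSmul hb.measurable hC f₀ g, hae] with x hn h₀ hlim
    simp only [Function.comp_apply, hn, h₀]
    exact ((hb.tendsto _).comp hlim).smul_const _

theorem continuous_compSmul (hq : q ≠ ⊤) (hb : Continuous b) (hC : ∀ s, |b s| ≤ C) :
    Continuous fun fg : Lp X p μ × Lp E q μ => compSmul hb.measurable hC fg.1 fg.2 := by
  refine continuous_prod_of_continuous_lipschitzWith' _ C.toNNReal
    (fun f => LipschitzWith.of_dist_le' fun g₁ g₂ => ?_)
    (fun g => continuous_compSmul_left hq hb hC g)
  rw [dist_eq_norm, dist_eq_norm]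
  exact norm_compSmul_sub_le hb.measurable hC f g₁ g₂

end CompSmul

/-- A nonexpansive function `β` with `β 0 = 0`, together with a function `β'` playing the role of
its derivative. Such truncations act on pairs `(f, ∇f)` by the chain rule, see `L2Pair.chain`. -/
structure IsTruncation (β β' : ℝ → ℝ) : Prop where
  lipschitz : LipschitzWith 1 β
  map_zero : β 0 = 0
  measurable : Measurable β'
  bound : ∀ s, |β' s| ≤ 1

lemma IsTruncation.norm_le {β β' : ℝ → ℝ} (h : IsTruncation β β') (s : ℝ) : ‖β s‖ ≤ ‖s‖ := by
  simpa [h.map_zero] using h.lipschitz.norm_sub_le s 0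

namespace L2Pair

variable {d : ℕ} {Ω : Set (Euc d)} {β β' : ℝ → ℝ}

/-- The pair `(β(f), β'(f) G)` attached to `(f, G)`: the chain rule for `β(f)` when `G = ∇f`. -/
noncomputable def chain (h : IsTruncation β β') (p : L2Pair Ω) : L2Pair Ω :=
  WithLp.toLp 2 (h.lipschitz.compLp h.map_zero p.fst, compSmul h.measurable h.bound p.fst p.snd)

lemma coeFn_chain_fst (h : IsTruncation β β') (p : L2Pair Ω) :
    (chain h p).fst =ᵐ[volume.restrict Ω] fun x => β (p.fst x) :=
  h.lipschitz.coeFn_compLp h.map_zero p.fst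

lemma coeFn_chain_snd (h : IsTruncation β β') (p : L2Pair Ω) :
    (chain h p).snd =ᵐ[volume.restrict Ω] fun x => β' (p.fst x) • p.snd x :=
  coeFn_compSmul h.measurable h.bound p.fst p.snd

lemma ae_norm_chain_fst_le (h : IsTruncation β β') (p : L2Pair Ω) :
    ∀ᵐ x ∂(volume.restrict Ω), ‖(chain h p).fst x‖ ≤ ‖p.fst x‖ :=
  (coeFn_chain_fst h p).mono fun _ hx => (congrArg norm hx).trans_le (h.norm_le _)

lemma ae_norm_chain_snd_le (h : IsTruncation β β') (p : L2Pair Ω) :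
    ∀ᵐ x ∂(volume.restrict Ω), ‖(chain h p).snd x‖ ≤ ‖p.snd x‖ :=
  (coeFn_chain_snd h p).mono fun x hx => by
    rw [hx, norm_smul]
    exact mul_le_of_le_one_left (norm_nonneg _) (h.bound _)

lemma norm_chain_le (h : IsTruncation β β') (p : L2Pair Ω) : ‖chain h p‖ ≤ ‖p‖ := by
  refine le_of_sq_le_sq ?_ (norm_nonneg _)
  rw [WithLp.prod_norm_sq_eq_of_L2, WithLp.prod_norm_sq_eq_of_L2]
  gcongr
  · exact Lp.norm_le_norm_of_ae_le (ae_norm_chain_fst_le h p)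
  · exact Lp.norm_le_norm_of_ae_le (ae_norm_chain_snd_le h p)

lemma continuous_chain (h : IsTruncation β β') (hβ' : Continuous β') :
    Continuous (chain h : L2Pair Ω → L2Pair Ω) := by
  have hfst := (WithLp.fstL 2 ℝ (L2 Ω) (L2Vec Ω)).continuous
  have hsnd := (WithLp.sndL 2 ℝ (L2 Ω) (L2Vec Ω)).continuous
  exact (WithLp.prod_continuous_toLp 2 _ _).comp
    (((h.lipschitz.continuous_compLp h.map_zero).comp hfst).prodMk
      ((continuous_compSmul (by simp) hβ' h.bound).comp (hfst.prodMk hsnd)))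

lemma tendsto_chain {β β' : ℕ → ℝ → ℝ} {β₀ β₀' : ℝ → ℝ} (h : ∀ n, IsTruncation (β n) (β' n))
    (h₀ : IsTruncation β₀ β₀') (hβ : ∀ s, Tendsto (fun n => β n s) atTop (𝓝 (β₀ s)))
    (hβ' : ∀ s, Tendsto (fun n => β' n s) atTop (𝓝 (β₀' s))) (p : L2Pair Ω) :
    Tendsto (fun n => chain (h n) p) atTop (𝓝 (chain h₀ p)) := by
  refine ((WithLp.prod_continuous_toLp 2 (L2 Ω) (L2Vec Ω)).tendsto _).comp
    (Tendsto.prodMk_nhds ?_ ?_)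
  · refine tendsto_Lp_of_dominated (by simp) p.fst (fun n => ae_norm_chain_fst_le (h n) p) ?_
    filter_upwards [ae_all_iff.2 fun n => coeFn_chain_fst (h n) p, coeFn_chain_fst h₀ p]
      with x hn h0
    exact ((hβ (p.fst x)).congr fun n => (hn n).symm).trans_eq (congrArg 𝓝 h0.symm)
  · refine tendsto_Lp_of_dominated (by simp) p.snd (fun n => ae_norm_chain_snd_le (h n) p) ?_
    filter_upwards [ae_all_iff.2 fun n => coeFn_chain_snd (h n) p, coeFn_chain_snd h₀ p]
      with x hn h0
    exact (((hβ' (p.fst x)).smul_const (p.snd x)).congr fun n => (hn n).symm).trans_eq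
      (congrArg 𝓝 h0.symm)

end L2Pair

section SmoothPosPart

/-- A smooth approximation, as `n → ∞`, of the indicator function of `(k, ∞)`. -/
noncomputable def smoothStep (k : ℝ) (n : ℕ) (s : ℝ) : ℝ :=
  Real.smoothTransition ((n + 1) * (s - k))

/-- The primitive of `smoothStep k n` vanishing at `0`, which approximates `s ↦ (s - k)⁺` when
`0 ≤ k`. -/
noncomputable def smoothPosPart (k : ℝ) (n : ℕ) (s : ℝ) : ℝ :=
  ∫ σ in (0 : ℝ)..s, smoothStep k n σ

variable {k : ℝ} {n : ℕ}

lemma contDiff_smoothStep : ContDiff ℝ ∞ (smoothStep k n) :=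
  Real.smoothTransition.contDiff.comp (by fun_prop)

lemma abs_smoothStep_le_one (s : ℝ) : |smoothStep k n s| ≤ 1 :=
  (abs_of_nonneg (Real.smoothTransition.nonneg _)).trans_le (Real.smoothTransition.le_one _)

lemma tendsto_smoothStep (k s : ℝ) :
    Tendsto (fun n => smoothStep k n s) atTop (𝓝 ((Ioi k).indicator 1 s)) := by
  by_cases hs : s ∈ Ioi k
  · have hlim : Tendsto (fun n : ℕ => ((n : ℝ) + 1) * (s - k)) atTop atTop :=
      (tendsto_natCast_atTop_atTop.atTop_add tendsto_const_nhds).atTop_mul_const (sub_pos.2 hs)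
    rw [indicator_of_mem hs]
    refine tendsto_const_nhds.congr' ?_
    filter_upwards [hlim.eventually_ge_atTop 1] with n hn
    exact (Real.smoothTransition.one_of_one_le hn).symm
  · rw [indicator_of_notMem hs]
    exact tendsto_const_nhds.congr fun n => (Real.smoothTransition.zero_of_nonpos
      (mul_nonpos_of_nonneg_of_nonpos (by positivity) (sub_nonpos.2 (not_lt.1 hs)))).symm

lemma hasDerivAt_smoothPosPart (s : ℝ) :
    HasDerivAt (smoothPosPart k n) (smoothStep k n s) s :=
  (contDiff_smoothStep.continuous.integral_hasStrictDerivAt 0 s).hasDerivAt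

lemma contDiff_smoothPosPart : ContDiff ℝ ∞ (smoothPosPart k n) := by
  have hderiv : deriv (smoothPosPart k n) = smoothStep k n :=
    funext fun s => (hasDerivAt_smoothPosPart s).deriv
  rw [contDiff_infty_iff_deriv, hderiv]
  exact ⟨fun s => (hasDerivAt_smoothPosPart s).differentiableAt, contDiff_smoothStep⟩

lemma intervalIntegral_indicator_Ioi_one (hk : 0 ≤ k) (s : ℝ) :
    ∫ σ in (0 : ℝ)..s, (Ioi k).indicator 1 σ = max (s - k) 0 := by
  have hIoc : ∀ a b, ∫ σ in Ioc a b, (Ioi k).indicator 1 σ = max (b - max a k) 0 := fun a b => by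
    rw [setIntegral_indicator measurableSet_Ioi, Ioc_inter_Ioi]
    simp [Real.volume_real_Ioc]
  rcases le_total 0 s with hs | hs
  · rw [intervalIntegral.integral_of_le hs, hIoc, max_eq_right hk]
  · rw [intervalIntegral.integral_of_ge hs, hIoc, max_eq_right (hs.trans hk),
      max_eq_right (by linarith), max_eq_right (by linarith), neg_zero]

theorem tendsto_smoothPosPart (hk : 0 ≤ k) (s : ℝ) :
    Tendsto (fun n => smoothPosPart k n s) atTop (𝓝 (max (s - k) 0)) := by
  rw [← intervalIntegral_indicator_Ioi_one hk]
  exact intervalIntegral.tendsto_integral_filter_of_dominated_convergence (fun _ => 1)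
    (Eventually.of_forall fun n => contDiff_smoothStep.continuous.aestronglyMeasurable)
    (Eventually.of_forall fun n => Eventually.of_forall fun σ _ => abs_smoothStep_le_one σ)
    intervalIntegrable_const (Eventually.of_forall fun σ _ => tendsto_smoothStep k σ)

lemma isTruncation_smoothPosPart (k : ℝ) (n : ℕ) :
    IsTruncation (smoothPosPart k n) (smoothStep k n) where
  lipschitz := by
    refine lipschitzWith_of_nnnorm_deriv_le
      (fun s => (hasDerivAt_smoothPosPart s).differentiableAt) fun s => ?_
    rw [(hasDerivAt_smoothPosPart s).deriv]
    exact abs_smoothStep_le_one s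
  map_zero := intervalIntegral.integral_same
  measurable := contDiff_smoothStep.continuous.measurable
  bound := abs_smoothStep_le_one

lemma isTruncation_posPart (hk : 0 ≤ k) :
    IsTruncation (fun s => max (s - k) 0) ((Ioi k).indicator 1) where
  lipschitz := by
    refine LipschitzWith.mk_one fun x y => ?_
    rw [Real.dist_eq, Real.dist_eq]
    simpa only [sub_sub_sub_cancel_right] using abs_max_sub_max_le_abs (x - k) (y - k) 0
  map_zero := by rw [zero_sub, max_eq_right (neg_nonpos.2 hk)]
  measurable := measurable_one.indicator measurableSet_Ioi
  bound s := (norm_indicator_le_norm_self (1 : ℝ → ℝ) s).trans_eq norm_one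

end SmoothPosPart

section TestPairs

variable {d : ℕ} {Ω : Set (Euc d)}

/-- The pairs `(φ, ∇φ)` with `φ` a test function; `H¹₀(Ω)` is the closure of this subspace. -/
def testPairs (Ω : Set (Euc d)) : Submodule ℝ (L2Pair Ω) where
  carrier := {p | ∃ φ : Euc d → ℝ, IsTestFunction Ω φ ∧
    p.fst =ᵐ[volume.restrict Ω] φ ∧ p.snd =ᵐ[volume.restrict Ω] ∇ φ}
  zero_mem' := by
    refine ⟨0, ⟨contDiff_const, HasCompactSupport.zero, ?_⟩, Lp.coeFn_zero _ _ _, ?_⟩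
    · exact (tsupport_eq_empty_iff.2 rfl).trans_subset (empty_subset _)
    · exact (Lp.coeFn_zero _ _ _).trans (Eventually.of_forall fun x =>
        (gradient_fun_const x (0 : ℝ)).symm)
  add_mem' := by
    rintro p q ⟨φ, hφ, hp₁, hp₂⟩ ⟨ψ, hψ, hq₁, hq₂⟩
    refine ⟨φ + ψ, hφ.add hψ, (Lp.coeFn_add _ _).trans (hp₁.add hq₁),
      ((Lp.coeFn_add _ _).trans (hp₂.add hq₂)).trans (Eventually.of_forall fun x => ?_)⟩
    rw [Pi.add_apply, gradient, gradient, gradient, ← map_add, fderiv_add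
      (hφ.1.differentiable (by simp) x) (hψ.1.differentiable (by simp) x)]
  smul_mem' := by
    rintro c p ⟨φ, hφ, hp₁, hp₂⟩
    refine ⟨c • φ, hφ.const_smul c, (Lp.coeFn_smul _ _).trans (hp₁.const_smul c),
      ((Lp.coeFn_smul _ _).trans (hp₂.const_smul c)).trans (Eventually.of_forall fun x => ?_)⟩
    rw [Pi.smul_apply, gradient, gradient, fderiv_const_smul (hφ.1.differentiable (by simp) x),
      map_smulₛₗ]
    rfl

lemma H10_eq_topologicalClosure_testPairs : H10 Ω = (testPairs Ω).topologicalClosure :=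
  congrArg Submodule.topologicalClosure (Submodule.span_eq (testPairs Ω))

lemma chain_mem_testPairs {β β' : ℝ → ℝ} (h : IsTruncation β β') (hβ : ContDiff ℝ ∞ β)
    (hβ' : ∀ s, HasDerivAt β (β' s) s) {p : L2Pair Ω} (hp : p ∈ testPairs Ω) :
    L2Pair.chain h p ∈ testPairs Ω := by
  obtain ⟨φ, hφ, hp₁, hp₂⟩ := hp
  refine ⟨β ∘ φ, ⟨hβ.comp hφ.1, hφ.2.1.comp_left h.map_zero,
    (tsupport_comp_subset h.map_zero φ).trans hφ.2.2⟩, ?_, ?_⟩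
  · filter_upwards [L2Pair.coeFn_chain_fst h p, hp₁] with x hx hφx
    rw [hx, hφx, Function.comp_apply]
  · filter_upwards [L2Pair.coeFn_chain_snd h p, hp₁, hp₂] with x hx hφx hgx
    have hcomp : HasFDerivAt (β ∘ φ) (β' (φ x) • fderiv ℝ φ x) x :=
      (hβ' (φ x)).comp_hasFDerivAt x (hφ.1.differentiable (by simp) x).hasFDerivAt
    rw [hx, hφx, hgx, gradient, gradient, hcomp.fderiv, map_smulₛₗ]
    rfl

lemma chain_mem_H10_of_contDiff {β β' : ℝ → ℝ} (h : IsTruncation β β') (hβ : ContDiff ℝ ∞ β)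
    (hβ' : ∀ s, HasDerivAt β (β' s) s) (hcont : Continuous β') {p : L2Pair Ω} (hp : p ∈ H10 Ω) :
    L2Pair.chain h p ∈ H10 Ω := by
  rw [H10_eq_topologicalClosure_testPairs] at hp ⊢
  exact map_mem_closure (L2Pair.continuous_chain h hcont) hp
    fun q hq => chain_mem_testPairs h hβ hβ' hq

/-- The smooth approximation of the truncation `(w - k)⁺` of `w ∈ H¹₀(Ω)`. -/
noncomputable def H10.smoothPosPart (k : ℝ) (n : ℕ) (w : H10 Ω) : H10 Ω :=
  ⟨L2Pair.chain (isTruncation_smoothPosPart k n) w.1, chain_mem_H10_of_contDiff _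
    contDiff_smoothPosPart hasDerivAt_smoothPosPart contDiff_smoothStep.continuous w.2⟩

variable {k : ℝ}

lemma H10.continuous_smoothPosPart (k : ℝ) (n : ℕ) :
    Continuous (H10.smoothPosPart k n : H10 Ω → H10 Ω) :=
  ((L2Pair.continuous_chain _ contDiff_smoothStep.continuous).comp
    continuous_subtype_val).subtype_mk _

lemma tendsto_chain_smoothPosPart (hk : 0 ≤ k) (p : L2Pair Ω) :
    Tendsto (fun n => L2Pair.chain (isTruncation_smoothPosPart k n) p) atTop
      (𝓝 (L2Pair.chain (isTruncation_posPart hk) p)) :=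
  L2Pair.tendsto_chain _ _ (tendsto_smoothPosPart hk) (tendsto_smoothStep k) p

/-- The truncation `(w - k)⁺` of `w ∈ H¹₀(Ω)`, for `k ≥ 0`. -/
noncomputable def H10.posPart (hk : 0 ≤ k) (w : H10 Ω) : H10 Ω :=
  ⟨L2Pair.chain (isTruncation_posPart hk) w.1,
    (Submodule.isClosed_topologicalClosure _).mem_of_tendsto (tendsto_chain_smoothPosPart hk w.1)
      (Eventually.of_forall fun n => (H10.smoothPosPart k n w).2)⟩

lemma H10.memLp_posPart {α : Type*} [MeasurableSpace α] {μ : Measure α} {p : ℝ≥0∞} (hk : 0 ≤ k)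
    {U : α → H10 Ω} (hU : MemLp U p μ) : MemLp (fun t => H10.posPart hk (U t)) p μ := by
  refine hU.mono (aestronglyMeasurable_of_tendsto_ae atTop
    (fun n => (H10.continuous_smoothPosPart k n).comp_aestronglyMeasurable hU.1)
    (Eventually.of_forall fun t => ?_)) (Eventually.of_forall fun t => ?_)
  · exact tendsto_subtype_rng.2 (tendsto_chain_smoothPosPart hk (U t).1)
  · exact L2Pair.norm_chain_le (isTruncation_posPart hk) (U t).1

end TestPairs

section Flux

variable {d : ℕ} {Ω : Set (Euc d)}

lemma integral_fderiv_apply_eq_zero {E : Type*} [NormedAddCommGroup E] [NormedSpace ℝ E]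
    [FiniteDimensional ℝ E] [MeasurableSpace E] [BorelSpace E] {μ : Measure E}
    [μ.IsAddHaarMeasure] {G : E → ℝ} (hG : ContDiff ℝ 1 G) (hsupp : HasCompactSupport G) (v : E) :
    ∫ x, fderiv ℝ G x v ∂μ = 0 := by
  have hint : Integrable (fun x => fderiv ℝ G x v) μ :=
    ((hG.continuous_fderiv one_ne_zero).clm_apply continuous_const).integrable_of_hasCompactSupport
      (hsupp.fderiv_apply ℝ v)
  simpa using integral_mul_fderiv_eq_neg_fderiv_mul_of_integrable (f := fun _ => 1) (g := G)
    (v := v) (μ := μ) (by simp) (by simpa using hint)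
    (by simpa using hG.continuous.integrable_of_hasCompactSupport hsupp)
    (by simp) (fun x _ => hG.differentiable one_ne_zero x)

lemma IsTestFunction.integral_comp_mul_inner_gradient {φ : Euc d → ℝ} (hφ : IsTestFunction Ω φ)
    {b : ℝ → ℝ} (hb : Continuous b) (v : Euc d) : ∫ x in Ω, b (φ x) * ⟪v, ∇ φ x⟫ = 0 := by
  let B : ℝ → ℝ := fun s => ∫ σ in (0 : ℝ)..s, b σ
  have hB : ∀ s, HasDerivAt B (b s) s := fun s => (hb.integral_hasStrictDerivAt 0 s).hasDerivAt
  have hB1 : ContDiff ℝ 1 B := by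
    rw [contDiff_one_iff_deriv, funext fun s => (hB s).deriv]
    exact ⟨fun s => (hB s).differentiableAt, hb⟩
  have hderiv : ∀ x, fderiv ℝ (B ∘ φ) x v = b (φ x) * ⟪v, ∇ φ x⟫ := fun x => by
    rw [((hB (φ x)).comp_hasFDerivAt x (hφ.1.differentiable (by simp) x).hasFDerivAt).fderiv,
      real_inner_comm, inner_gradient_left]
    rfl
  have hout : ∀ x ∉ Ω, b (φ x) * ⟪v, ∇ φ x⟫ = 0 := fun x hx => by
    rw [real_inner_comm, inner_gradient_left,
      image_eq_zero_of_notMem_tsupport fun h => hx (hφ.2.2 (tsupport_fderiv_subset ℝ h)),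
      zero_apply, mul_zero]
  rw [setIntegral_eq_integral_of_forall_compl_eq_zero hout]
  simpa only [hderiv] using integral_fderiv_apply_eq_zero (μ := volume)
    (hB1.comp (hφ.1.of_le (by simp)))
    (hφ.2.1.comp_left (intervalIntegral.integral_same : B 0 = 0)) v

variable [IsFiniteMeasure (volume.restrict Ω)]

lemma integral_comp_mul_inner_eq_zero_of_mem_H10 {b : ℝ → ℝ} (hb : Continuous b) {C : ℝ}
    (hC : ∀ s, |b s| ≤ C) (v : Euc d) {p : L2Pair Ω} (hp : p ∈ H10 Ω) :
    ∫ x in Ω, b (p.fst x) * ⟪v, p.snd x⟫ = 0 := by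
  have hinner : ∀ q : L2Pair Ω, ⟪Lp.const 2 (volume.restrict Ω) v,
      compSmul hb.measurable hC q.fst q.snd⟫ = ∫ x in Ω, b (q.fst x) * ⟪v, q.snd x⟫ := by
    refine fun q => (L2.inner_def _ _).trans (integral_congr_ae ?_)
    filter_upwards [Lp.coeFn_const 2 (volume.restrict Ω) v,
      coeFn_compSmul hb.measurable hC q.fst q.snd] with x hv hbx
    rw [hv, hbx, Function.const_apply, inner_smul_right]
  have hclosed : IsClosed {q : L2Pair Ω | ⟪Lp.const 2 (volume.restrict Ω) v,
      compSmul hb.measurable hC q.fst q.snd⟫ = 0} :=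
    isClosed_eq (continuous_const.inner ((continuous_compSmul (by simp) hb hC).comp
      (WithLp.prod_continuous_ofLp 2 _ _))) continuous_const
  rw [H10_eq_topologicalClosure_testPairs] at hp
  rw [← hinner]
  refine closure_minimal ?_ hclosed hp
  rintro q ⟨φ, hφ, hq₁, hq₂⟩
  refine (hinner q).trans (Eq.trans (integral_congr_ae ?_)
    (hφ.integral_comp_mul_inner_gradient hb v))
  filter_upwards [hq₁, hq₂] with x h₁ h₂
  rw [h₁, h₂]

theorem integral_inner_comp_eq_zero_of_mem_H10 {F : ℝ → Euc d} (hF : Continuous F) {C : ℝ}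
    (hC : ∀ s, ‖F s‖ ≤ C) {p : L2Pair Ω} (hp : p ∈ H10 Ω) :
    ∫ x in Ω, ⟪F (p.fst x), p.snd x⟫ = 0 := by
  let e := EuclideanSpace.basisFun (Fin d) ℝ
  have hcont : ∀ j, Continuous fun s => ⟪F s, e j⟫ := fun j => hF.inner continuous_const
  have hbound : ∀ j s, |⟪F s, e j⟫| ≤ C := fun j s => by
    simpa [e.norm_eq_one] using (abs_real_inner_le_norm (F s) (e j)).trans
      (mul_le_mul_of_nonneg_right (hC s) (norm_nonneg _))
  have hint : ∀ j, Integrable (fun x => ⟪F (p.fst x), e j⟫ * ⟪e j, p.snd x⟫)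
      (volume.restrict Ω) := fun j => by
    simpa only [inner_smul_right] using ((memLp_comp_smul (hcont j).measurable (hbound j) p.fst
      p.snd).integrable (by norm_num)).const_inner (𝕜 := ℝ) (e j)
  simp only [fun x => (e.sum_inner_mul_inner (F (p.fst x)) (p.snd x)).symm]
  rw [integral_finsetSum _ fun j _ => hint j]
  exact Finset.sum_eq_zero fun j _ =>
    integral_comp_mul_inner_eq_zero_of_mem_H10 (hcont j) (hbound j) (e j) hp

end Flux

section Excess

variable {α : Type*} [MeasurableSpace α] {μ : Measure α}

lemma integral_le_integral_of_ae_le_of_ae_nonneg {f g : α → ℝ} (hg : Integrable g μ)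
    (hg0 : 0 ≤ᵐ[μ] g) (hle : f ≤ᵐ[μ] g) : ∫ x, f x ∂μ ≤ ∫ x, g x ∂μ := by
  by_cases hf : Integrable f μ
  · exact integral_mono_ae hf hg hle
  · exact (integral_undef hf).trans_le (integral_nonneg_of_ae hg0)

lemma L2_inner_eq_integral_mul (f g : Lp ℝ 2 μ) : ⟪f, g⟫ = ∫ x, f x * g x ∂μ := by
  simp only [L2.inner_def, RCLike.inner_apply, conj_trivial, mul_comm]

lemma real_inner_le_half_sq_add_half_sq {X : Type*} [NormedAddCommGroup X]
    [InnerProductSpace ℝ X] (x y : X) : ⟪x, y⟫ ≤ ‖x‖ ^ 2 / 2 + ‖y‖ ^ 2 / 2 := by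
  linarith [real_inner_le_norm x y, two_mul_le_add_sq ‖x‖ ‖y‖]

lemma integral_le_mul_half_sq_norm_add {L : ℝ} (hL : 0 ≤ L) {P Q : Lp ℝ 2 μ} (hP : 0 ≤ᵐ[μ] P)
    (hQ : 0 ≤ᵐ[μ] Q) {g : α → ℝ} (hg : ∀ᵐ x ∂μ, g x ≤ L * (P x * Q x)) :
    ∫ x, g x ∂μ ≤ L * (‖P‖ ^ 2 / 2 + ‖Q‖ ^ 2 / 2) := by
  have hPQ : Integrable (fun x => P x * Q x) μ := (Lp.memLp P).integrable_mul (Lp.memLp Q)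
  calc ∫ x, g x ∂μ ≤ ∫ x, L * (P x * Q x) ∂μ := by
        refine integral_le_integral_of_ae_le_of_ae_nonneg (hPQ.const_mul L) ?_ hg
        filter_upwards [hP, hQ] with x hPx hQx
        exact mul_nonneg hL (mul_nonneg hPx hQx)
    _ = L * ⟪P, Q⟫ := by rw [integral_const_mul, L2_inner_eq_integral_mul]
    _ ≤ L * (‖P‖ ^ 2 / 2 + ‖Q‖ ^ 2 / 2) :=
        mul_le_mul_of_nonneg_left (real_inner_le_half_sq_add_half_sq P Q) hL

variable [IsFiniteMeasure μ]

/-- The excess `(f - k)⁺` of `f ∈ L²` over the level `k`. Lower bounds `l ≤ f` are expressed through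
`excess (-l) (-f) = (l - f)⁺`. -/
noncomputable def excess (k : ℝ) (f : Lp ℝ 2 μ) : Lp ℝ 2 μ :=
  Lp.posPart (f - Lp.const 2 μ k)

lemma coeFn_excess (k : ℝ) (f : Lp ℝ 2 μ) : excess k f =ᵐ[μ] fun x => max (f x - k) 0 := by
  filter_upwards [Lp.coeFn_posPart (f - Lp.const 2 μ k), Lp.coeFn_sub f (Lp.const 2 μ k),
    Lp.coeFn_const 2 μ k] with x hpos hsub hconst
  rw [excess, hpos, hsub, Pi.sub_apply, hconst, Function.const_apply]

lemma coeFn_excess_of_ae_eq (k : ℝ) {w : α → ℝ} {f : Lp ℝ 2 μ} (hw : w =ᵐ[μ] f) :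
    excess k f =ᵐ[μ] fun x => max (w x - k) 0 :=
  (coeFn_excess k f).trans (hw.mono fun x hx => by simp only [hx])

lemma excess_nonneg (k : ℝ) (f : Lp ℝ 2 μ) : 0 ≤ᵐ[μ] excess k f :=
  (coeFn_excess k f).mono fun _ hx => (le_max_right _ _).trans_eq hx.symm

lemma ae_le_of_excess_eq_zero {k : ℝ} {f : Lp ℝ 2 μ} (hf : excess k f = 0) : ∀ᵐ x ∂μ, f x ≤ k := by
  filter_upwards [coeFn_excess k f, Lp.coeFn_zero ℝ 2 μ] with x hx hzero
  rw [hf, hzero, Pi.zero_apply] at hx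
  exact sub_nonpos.1 ((le_max_left _ _).trans_eq hx.symm)

lemma norm_excess_le (k : ℝ) (f : Lp ℝ 2 μ) : ‖excess k f‖ ≤ ‖f - Lp.const 2 μ k‖ := by
  refine Lp.norm_le_norm_of_ae_le ?_
  filter_upwards [Lp.coeFn_posPart (f - Lp.const 2 μ k)] with x hx
  rw [excess, hx, Real.norm_of_nonneg (le_max_right _ _)]
  exact max_le (le_abs_self _) (abs_nonneg _)

lemma memLp_excess {β : Type*} [MeasurableSpace β] {ν : Measure β} [IsFiniteMeasure ν]
    {p : ℝ≥0∞} (k : ℝ) {W : β → Lp ℝ 2 μ} (hW : MemLp W p ν) :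
    MemLp (fun t => excess k (W t)) p ν := by
  have hsub : MemLp (fun t => W t - Lp.const 2 μ k) p ν := hW.sub (memLp_const _)
  exact hsub.mono (Lp.continuous_posPart.comp_aestronglyMeasurable hsub.1)
    (Eventually.of_forall fun t => norm_excess_le k (W t))

lemma half_sq_norm_excess_sub_le (k : ℝ) (f g : Lp ℝ 2 μ) :
    ‖excess k g‖ ^ 2 / 2 - ‖excess k f‖ ^ 2 / 2 ≤ ⟪g - f, excess k g⟫ := by
  have hmono : ⟪excess k g - excess k f, excess k g⟫ ≤ ⟪g - f, excess k g⟫ := by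
    rw [L2_inner_eq_integral_mul, L2_inner_eq_integral_mul]
    refine integral_mono_ae ((Lp.memLp _).integrable_mul (Lp.memLp _))
      ((Lp.memLp _).integrable_mul (Lp.memLp _)) ?_
    filter_upwards [coeFn_excess k f, coeFn_excess k g, Lp.coeFn_sub g f,
      Lp.coeFn_sub (excess k g) (excess k f)] with x hf hg hsub hesub
    rw [hesub, hsub, Pi.sub_apply, Pi.sub_apply, hf, hg]
    rcases le_total (g x) k with h | h
    · rw [max_eq_right (sub_nonpos.2 h), mul_zero, mul_zero]
    · rw [max_eq_left (sub_nonneg.2 h)]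
      exact mul_le_mul_of_nonneg_right (by linarith [le_max_left (f x - k) 0]) (sub_nonneg.2 h)
  rw [inner_sub_left, real_inner_self_eq_norm_sq] at hmono
  linarith [real_inner_le_half_sq_add_half_sq (excess k f) (excess k g)]

end Excess

section InitialValue

variable {d : ℕ} {Ω : Set (Euc d)} {T : ℝ}

lemma nhdsGT_inf_ae_le_ae_timeMeasure (hT : 0 < T) :
    𝓝[>] (0 : ℝ) ⊓ ae volume ≤ ae (timeMeasure T) := by
  rw [ae_restrict_eq measurableSet_Ioo, inf_comm]
  exact inf_le_inf_left _ (le_principal_iff.2 (Ioo_mem_nhdsGT hT))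

lemma HasInitialValue.tendsto_half_sq_norm_excess [IsFiniteMeasure (volume.restrict Ω)]
    (hT : 0 < T) {w : ℝ → Euc d → ℝ} {w₀ : Euc d → ℝ} (h : HasInitialValue Ω w w₀)
    {W : ℝ → L2 Ω} (hW : ∀ᵐ t ∂timeMeasure T, w t =ᵐ[volume.restrict Ω] W t) {k : ℝ}
    (hw₀ : ∀ᵐ x ∂(volume.restrict Ω), w₀ x ≤ k) :
    Tendsto (fun t => ‖excess k (W t)‖ ^ 2 / 2) (𝓝[>] 0 ⊓ ae volume) (𝓝 0) := by
  have hle : ∀ᵐ t ∂timeMeasure T, eLpNorm (excess k (W t)) 2 (volume.restrict Ω)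
      ≤ eLpNorm (w t - w₀) 2 (volume.restrict Ω) := by
    filter_upwards [hW] with t ht
    refine eLpNorm_mono_ae ?_
    filter_upwards [ht, hw₀, coeFn_excess k (W t)] with x hx hx₀ hex
    rw [hex, Real.norm_of_nonneg (le_max_right _ _), Pi.sub_apply, hx, Real.norm_eq_abs]
    exact max_le (by linarith [le_abs_self (W t x - w₀ x)]) (abs_nonneg _)
  have henorm : Tendsto (fun t => eLpNorm (excess k (W t)) 2 (volume.restrict Ω))
      (𝓝[>] 0 ⊓ ae volume) (𝓝 0) :=
    tendsto_of_tendsto_of_tendsto_of_le_of_le' tendsto_const_nhds h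
      (Eventually.of_forall fun _ => zero_le) (nhdsGT_inf_ae_le_ae_timeMeasure hT hle)
  have hnorm : Tendsto (fun t => ‖excess k (W t)‖) (𝓝[>] 0 ⊓ ae volume) (𝓝 0) :=
    (ENNReal.tendsto_toReal ENNReal.zero_ne_top).comp henorm
  simpa using (hnorm.pow 2).div_const 2

end InitialValue

section Localization

variable {T s : ℝ}

lemma integral_apply_indicator_Ioo {Y : Type*} [Zero Y] (hs : s ∈ Ioo 0 T) {K : ℝ → Y → ℝ}
    (hK : ∀ t, K t 0 = 0) (φ : ℝ → Y) :
    ∫ t, K t ((Ioo 0 s).indicator φ t) ∂(timeMeasure T) = ∫ t in (0 : ℝ)..s, K t (φ t) := by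
  have hind : (fun t => K t ((Ioo 0 s).indicator φ t))
      = (Ioo 0 s).indicator fun t => K t (φ t) := by
    ext t
    by_cases ht : t ∈ Ioo 0 s
    · rw [indicator_of_mem ht, indicator_of_mem ht]
    · rw [indicator_of_notMem ht, indicator_of_notMem ht, hK]
  rw [hind, integral_indicator measurableSet_Ioo, Measure.restrict_restrict measurableSet_Ioo,
    inter_eq_self_of_subset_left (Ioo_subset_Ioo_right hs.2.le), ← integral_Ioc_eq_integral_Ioo,
    ← intervalIntegral.integral_of_le hs.1.le]

lemma intervalIntegral_le_const_mul_of_ae_le {E g : ℝ → ℝ} {L : ℝ} (hs : s ∈ Ioo 0 T)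
    (hL : 0 ≤ L) (hE : Integrable E (timeMeasure T)) (hE0 : ∀ t, 0 ≤ E t)
    (hle : ∀ᵐ t ∂(timeMeasure T), g t ≤ L * E t) :
    ∫ t in (0 : ℝ)..s, g t ≤ L * ∫ t in (0 : ℝ)..s, E t := by
  have hsub : Ioc 0 s ⊆ Ioo 0 T := Ioc_subset_Ioo_right hs.2
  rw [← intervalIntegral.integral_const_mul, intervalIntegral.integral_of_le hs.1.le,
    intervalIntegral.integral_of_le hs.1.le]
  exact integral_le_integral_of_ae_le_of_ae_nonneg
    ((IntegrableOn.mono_set hE hsub).const_mul L)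
    (Eventually.of_forall fun t => mul_nonneg hL (hE0 t))
    (ae_restrict_of_ae_restrict_of_subset hsub hle)

end Localization

section PosPart

variable {d : ℕ} {Ω : Set (Euc d)} {k : ℝ}

lemma H10.coeFn_posPart_fst (hk : 0 ≤ k) (w : H10 Ω) :
    (H10.posPart hk w).1.fst =ᵐ[volume.restrict Ω] fun x => max (w.1.fst x - k) 0 :=
  L2Pair.coeFn_chain_fst (isTruncation_posPart hk) w.1

lemma H10.coeFn_posPart_snd (hk : 0 ≤ k) (w : H10 Ω) :
    (H10.posPart hk w).1.snd =ᵐ[volume.restrict Ω]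
      fun x => (Ioi k).indicator (1 : ℝ → ℝ) (w.1.fst x) • w.1.snd x :=
  L2Pair.coeFn_chain_snd (isTruncation_posPart hk) w.1

lemma H10.fst_posPart [IsFiniteMeasure (volume.restrict Ω)] (hk : 0 ≤ k) (w : H10 Ω) :
    (H10.posPart hk w).1.fst = excess k w.1.fst :=
  Lp.ext ((H10.coeFn_posPart_fst hk w).trans (coeFn_excess k w.1.fst).symm)

lemma H10.integral_mul_inner_posPart_nonneg (hk : 0 ≤ k) (w : H10 Ω) {a : Euc d → ℝ}
    (ha : ∀ x, 0 ≤ a x) : 0 ≤ ∫ x in Ω, a x * ⟪w.1.snd x, (H10.posPart hk w).1.snd x⟫ := by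
  refine integral_nonneg_of_ae ?_
  filter_upwards [H10.coeFn_posPart_snd hk w] with x hx
  rw [hx, inner_smul_right]
  exact mul_nonneg (ha x) (mul_nonneg (indicator_nonneg (fun _ _ => zero_le_one) _)
    real_inner_self_nonneg)

lemma H10.integral_inner_comp_posPart_eq_zero [IsFiniteMeasure (volume.restrict Ω)] (hk : 0 ≤ k)
    (w : H10 Ω) {F : ℝ → Euc d} (hF : Continuous F) {C : ℝ} (hC : ∀ s, ‖F s‖ ≤ C) :
    ∫ x in Ω, ⟪F (w.1.fst x), (H10.posPart hk w).1.snd x⟫ = 0 := by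
  rw [← integral_inner_comp_eq_zero_of_mem_H10 (F := fun s => F (k + s)) (by fun_prop)
    (fun s => hC (k + s)) (H10.posPart hk w).2]
  refine integral_congr_ae ?_
  filter_upwards [H10.coeFn_posPart_fst hk w, H10.coeFn_posPart_snd hk w] with x hfst hsnd
  rw [hfst, hsnd]
  by_cases h : k < w.1.fst x
  · rw [max_eq_left (sub_nonneg.2 h.le), add_sub_cancel]
  · rw [indicator_of_notMem (s := Ioi k) h, zero_smul, inner_zero_right, inner_zero_right]

lemma H10.coeFn_fst_zero : (0 : H10 Ω).1.fst =ᵐ[volume.restrict Ω] 0 :=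
  Lp.coeFn_zero ℝ 2 (volume.restrict Ω)

lemma H10.coeFn_snd_zero : (0 : H10 Ω).1.snd =ᵐ[volume.restrict Ω] 0 :=
  Lp.coeFn_zero (Euc d) 2 (volume.restrict Ω)

end PosPart

section WeakEquations

variable {d : ℕ} {Ω : Set (Euc d)} {T k : ℝ}

/-- The weak form of `∂ₜu = ∇ · (a ∇u - f) + r` in `(0, T) × Ω` with `u = 0` on `∂Ω`, where `U t` is
`u(t)` as an element of `H¹₀(Ω)` and `U'` is the time derivative. The coefficients `a`, `f`, `r` are
arbitrary functions of `(t, x)`: in a solution of the system they are `D(u,v)`, `F(u,v)` and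
`Ψ₁(u,v)`. -/
def IsWeakParabolicEquation (T : ℝ) (a : ℝ → Euc d → ℝ) (f : ℝ → Euc d → Euc d)
    (r : ℝ → Euc d → ℝ) (U : ℝ → H10 Ω) (U' : ℝ → Hneg1 Ω) : Prop :=
  ∀ φ : ℝ → H10 Ω, MemLp φ 2 (timeMeasure T) →
    (∫ t, U' t (φ t) ∂(timeMeasure T))
      + (∫ t, (∫ x in Ω, a t x * ⟪(U t).1.snd x, (φ t).1.snd x⟫) ∂(timeMeasure T))
    = (∫ t, (∫ x in Ω, ⟪f t x, (φ t).1.snd x⟫) ∂(timeMeasure T))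
      + (∫ t, (∫ x in Ω, r t x * (φ t).1.fst x) ∂(timeMeasure T))

/-- The weak form of `∂ₜv = r` in `(0, T) × Ω`, where `V'` is the time derivative of `v`. -/
def IsWeakRateEquation (T : ℝ) (r : ℝ → Euc d → ℝ) (V' : ℝ → L2 Ω) : Prop :=
  ∀ ξ : ℝ → L2 Ω, MemLp ξ 2 (timeMeasure T) →
    ∫ t, (∫ x in Ω, V' t x * ξ t x) ∂(timeMeasure T)
      = ∫ t, (∫ x in Ω, r t x * ξ t x) ∂(timeMeasure T)

variable {a : ℝ → Euc d → ℝ} {f : ℝ → Euc d → Euc d} {r : ℝ → Euc d → ℝ} {U : ℝ → H10 Ω}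
  {U' : ℝ → Hneg1 Ω} {V V' : ℝ → L2 Ω}

lemma IsWeakParabolicEquation.intervalIntegral_eq (h : IsWeakParabolicEquation T a f r U U')
    {φ : ℝ → H10 Ω} (hφ : MemLp φ 2 (timeMeasure T)) {s : ℝ} (hs : s ∈ Ioo 0 T) :
    (∫ t in (0 : ℝ)..s, U' t (φ t))
      + (∫ t in (0 : ℝ)..s, ∫ x in Ω, a t x * ⟪(U t).1.snd x, (φ t).1.snd x⟫)
    = (∫ t in (0 : ℝ)..s, ∫ x in Ω, ⟪f t x, (φ t).1.snd x⟫)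
      + (∫ t in (0 : ℝ)..s, ∫ x in Ω, r t x * (φ t).1.fst x) := by
  have htest := h _ (hφ.indicator (measurableSet_Ioo (a := 0) (b := s)))
  rwa [integral_apply_indicator_Ioo hs (K := fun t (w : H10 Ω) => U' t w) fun t => map_zero _,
    integral_apply_indicator_Ioo hs
      (K := fun t (w : H10 Ω) => ∫ x in Ω, a t x * ⟪(U t).1.snd x, w.1.snd x⟫),
    integral_apply_indicator_Ioo hs (K := fun t (w : H10 Ω) => ∫ x in Ω, ⟪f t x, w.1.snd x⟫),
    integral_apply_indicator_Ioo hs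
      (K := fun t (w : H10 Ω) => ∫ x in Ω, r t x * w.1.fst x)] at htest
  all_goals refine fun t => integral_eq_zero_of_ae ?_
  · filter_upwards [H10.coeFn_fst_zero (Ω := Ω)] with x hx
    rw [hx, Pi.zero_apply, mul_zero]
  · filter_upwards [H10.coeFn_snd_zero (Ω := Ω)] with x hx
    rw [hx, Pi.zero_apply, inner_zero_right, Pi.zero_apply]
  · filter_upwards [H10.coeFn_snd_zero (Ω := Ω)] with x hx
    rw [hx, Pi.zero_apply, inner_zero_right, mul_zero, Pi.zero_apply]

lemma IsWeakRateEquation.intervalIntegral_eq (h : IsWeakRateEquation T r V')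
    {ξ : ℝ → L2 Ω} (hξ : MemLp ξ 2 (timeMeasure T)) {s : ℝ} (hs : s ∈ Ioo 0 T) :
    ∫ t in (0 : ℝ)..s, ⟪V' t, ξ t⟫ = ∫ t in (0 : ℝ)..s, ∫ x in Ω, r t x * ξ t x := by
  have htest := h _ (hξ.indicator (measurableSet_Ioo (a := 0) (b := s)))
  simp only [← L2_inner_eq_integral_mul] at htest
  rwa [integral_apply_indicator_Ioo hs (K := fun t (w : L2 Ω) => ⟪V' t, w⟫)
      fun t => inner_zero_right _,
    integral_apply_indicator_Ioo hs (K := fun t (w : L2 Ω) => ∫ x in Ω, r t x * w x)] at htest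
  refine fun t => integral_eq_zero_of_ae ?_
  filter_upwards [Lp.coeFn_zero ℝ 2 (volume.restrict Ω)] with x hx
  rw [hx, Pi.zero_apply, mul_zero]

lemma HasWeakTimeDeriv.clm_comp {X Y : Type*} [NormedAddCommGroup X] [NormedSpace ℝ X]
    [CompleteSpace X] [NormedAddCommGroup Y] [NormedSpace ℝ Y] [CompleteSpace Y] {W W' : ℝ → X}
    (h : HasWeakTimeDeriv T W W') (hW : Integrable W (timeMeasure T))
    (hW' : Integrable W' (timeMeasure T)) (A : X →L[ℝ] Y) :
    HasWeakTimeDeriv T (fun t => A (W t)) fun t => A (W' t) := by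
  intro η hη
  simp only [← map_smul]
  rw [A.integral_comp_comm ((isTestFunction_deriv hη).integrable_smul hW),
    A.integral_comp_comm (hη.integrable_smul hW'), h η hη, map_neg]

lemma HasWeakTimeDeriv.ae_le_integral_of_inner_comp {Y H : Type*} [NormedAddCommGroup Y]
    [NormedSpace ℝ Y] [NormedAddCommGroup H] [InnerProductSpace ℝ H] {i : Y →L[ℝ] H}
    {W φ : ℝ → Y} {W' : ℝ → Y →L[ℝ] ℝ} {f : ℝ → ℝ}
    (hd : HasWeakTimeDeriv T (fun t => (innerSL ℝ (i (W t))).comp i) W') (hT : 0 < T)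
    (hW : MemLp W 2 (timeMeasure T)) (hW' : MemLp W' 2 (timeMeasure T))
    (hφ : MemLp φ 2 (timeMeasure T)) (hf : Integrable f (timeMeasure T))
    (hsub : ∀ s t, f t - f s ≤ ⟪i (W t) - i (W s), i (φ t)⟫)
    (h0 : Tendsto f (𝓝[>] 0 ⊓ ae volume) (𝓝 0)) :
    ∀ᵐ s ∂(timeMeasure T), f s ≤ ∫ t in (0 : ℝ)..s, W' t (φ t) :=
  hd.ae_le_integral hT ENNReal.ofNat_ne_top
    (((((ContinuousLinearMap.compL ℝ Y H ℝ).flip i).comp (innerSL ℝ)).comp i).integrable_comp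
      (hW.integrable one_le_two)) hW' hφ hf
    (fun s t => (hsub s t).trans_eq (inner_sub_left _ _ _)) h0

lemma integrable_half_sq_norm {α X : Type*} [MeasurableSpace α] {μ : Measure α}
    [NormedAddCommGroup X] {P : α → X} (hP : MemLp P 2 μ) :
    Integrable (fun t => ‖P t‖ ^ 2 / 2) μ :=
  (hP.integrable_norm_pow two_ne_zero).div_const 2

variable [IsFiniteMeasure (volume.restrict Ω)]

/-- Testing with `(u - k)⁺`, the diffusion term has a sign and the flux term vanishes. -/
lemma IsWeakParabolicEquation.intervalIntegral_posPart_le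
    (h : IsWeakParabolicEquation T a f r U U') (hU : MemLp U 2 (timeMeasure T))
    (ha : ∀ t x, 0 ≤ a t x) {F : ℝ → Euc d} (hF : Continuous F) {C : ℝ} (hC : ∀ s, ‖F s‖ ≤ C)
    (hf : ∀ᵐ t ∂(timeMeasure T), ∀ᵐ x ∂(volume.restrict Ω), f t x = F ((U t).1.fst x))
    (hk : 0 ≤ k) {s : ℝ} (hs : s ∈ Ioo 0 T) :
    ∫ t in (0 : ℝ)..s, U' t (H10.posPart hk (U t))
      ≤ ∫ t in (0 : ℝ)..s, ∫ x in Ω, r t x * excess k (U t).1.fst x := by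
  have htest := h.intervalIntegral_eq (H10.memLp_posPart hk hU) hs
  have hdiffusion := intervalIntegral.integral_nonneg (μ := volume) hs.1.le fun t _ =>
    H10.integral_mul_inner_posPart_nonneg hk (U t) (ha t)
  have hflux : ∫ t in (0 : ℝ)..s, ∫ x in Ω, ⟪f t x, (H10.posPart hk (U t)).1.snd x⟫ = 0 := by
    rw [intervalIntegral.integral_of_le hs.1.le]
    refine integral_eq_zero_of_ae ?_
    filter_upwards [ae_restrict_of_ae_restrict_of_subset (Ioc_subset_Ioo_right hs.2) hf]
      with t ht
    rw [Pi.zero_apply, ← H10.integral_inner_comp_posPart_eq_zero hk (U t) hF hC]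
    exact integral_congr_ae (ht.mono fun x hx => by simp only [hx])
  rw [hflux, zero_add] at htest
  simp only [H10.fst_posPart] at htest
  linarith

theorem IsWeakParabolicEquation.ae_half_sq_norm_excess_le
    (h : IsWeakParabolicEquation T a f r U U') (hT : 0 < T) (hU : MemLp U 2 (timeMeasure T))
    (hU' : MemLp U' 2 (timeMeasure T))
    (hd : HasWeakTimeDeriv T (fun t => L2.toHneg1 (U t).1.fst) U') (ha : ∀ t x, 0 ≤ a t x)
    {F : ℝ → Euc d} (hF : Continuous F) {C : ℝ} (hC : ∀ s, ‖F s‖ ≤ C)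
    (hf : ∀ᵐ t ∂(timeMeasure T), ∀ᵐ x ∂(volume.restrict Ω), f t x = F ((U t).1.fst x))
    (hk : 0 ≤ k) (h0 : Tendsto (fun t => ‖excess k (U t).1.fst‖ ^ 2 / 2) (𝓝[>] 0 ⊓ ae volume)
      (𝓝 0)) :
    ∀ᵐ s ∂(timeMeasure T), ‖excess k (U s).1.fst‖ ^ 2 / 2
      ≤ ∫ t in (0 : ℝ)..s, ∫ x in Ω, r t x * excess k (U t).1.fst x := by
  have hE : MemLp (fun t => excess k (U t).1.fst) 2 (timeMeasure T) :=
    memLp_excess k (((WithLp.fstL 2 ℝ (L2 Ω) (L2Vec Ω)).comp (H10 Ω).subtypeL).comp_memLp' hU)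
  have hle := hd.ae_le_integral_of_inner_comp
    (i := (WithLp.fstL 2 ℝ (L2 Ω) (L2Vec Ω)).comp (H10 Ω).subtypeL) hT hU hU'
    (H10.memLp_posPart hk hU) (integrable_half_sq_norm hE)
    (fun s t => (half_sq_norm_excess_sub_le k _ _).trans_eq
      (by rw [← H10.fst_posPart hk]; rfl)) h0
  filter_upwards [hle, ae_restrict_mem measurableSet_Ioo] with s hle hs
  exact hle.trans (h.intervalIntegral_posPart_le hU ha hF hC hf hk hs)

theorem IsWeakRateEquation.ae_half_sq_norm_excess_le (h : IsWeakRateEquation T r V') (hT : 0 < T)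
    (hV : MemLp V 2 (timeMeasure T)) (hV' : MemLp V' 2 (timeMeasure T))
    (hd : HasWeakTimeDeriv T V V')
    (h0 : Tendsto (fun t => ‖excess k (V t)‖ ^ 2 / 2) (𝓝[>] 0 ⊓ ae volume) (𝓝 0)) :
    ∀ᵐ s ∂(timeMeasure T), ‖excess k (V s)‖ ^ 2 / 2
      ≤ ∫ t in (0 : ℝ)..s, ∫ x in Ω, r t x * excess k (V t) x := by
  have hE : MemLp (fun t => excess k (V t)) 2 (timeMeasure T) := memLp_excess k hV
  have hd' := hd.clm_comp (hV.integrable one_le_two) (hV'.integrable one_le_two)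
    (innerSL ℝ : L2 Ω →L[ℝ] L2 Ω →L[ℝ] ℝ)
  have hle := hd'.ae_le_integral hT ENNReal.ofNat_ne_top
    ((innerSL ℝ).integrable_comp (hV.integrable one_le_two)) ((innerSL ℝ).comp_memLp' hV') hE
    (integrable_half_sq_norm hE)
    (fun s t => by rw [← map_sub]; exact half_sq_norm_excess_sub_le k _ _) h0
  filter_upwards [hle, ae_restrict_mem measurableSet_Ioo] with s hle hs
  exact hle.trans_eq (h.intervalIntegral_eq hE hs)

end WeakEquations

section Competition

/-- `Ψ` is Lipschitz with constants `Ψu`, `Ψv` in its two variables and nonincreasing in each: the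
reaction term of a species whose growth is inhibited by itself and by the other one. -/
structure IsCompetitive (Ψu Ψv : ℝ) (Ψ : ℝ → ℝ → ℝ) : Prop where
  lipschitz : ∀ a₁ a₂ b₁ b₂, |Ψ a₁ b₁ - Ψ a₂ b₂| ≤ Ψu * |a₁ - a₂| + Ψv * |b₁ - b₂|
  antitone_left : ∀ b, Antitone fun a => Ψ a b
  antitone_right : ∀ a, Antitone (Ψ a)

variable {Ψu Ψv k l : ℝ} {Ψ : ℝ → ℝ → ℝ}

lemma IsCompetitive.swap (h : IsCompetitive Ψu Ψv Ψ) :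
    IsCompetitive Ψv Ψu fun b a => Ψ a b where
  lipschitz b₁ b₂ a₁ a₂ := (h.lipschitz a₁ a₂ b₁ b₂).trans_eq (add_comm _ _)
  antitone_left := h.antitone_right
  antitone_right := h.antitone_left

lemma IsCompetitive.neg (h : IsCompetitive Ψu Ψv Ψ) :
    IsCompetitive Ψu Ψv fun a b => -Ψ (-a) (-b) where
  lipschitz a₁ a₂ b₁ b₂ := by
    have hlip := h.lipschitz (-a₂) (-a₁) (-b₂) (-b₁)
    rwa [neg_sub_neg, neg_sub_neg, ← neg_sub_neg (Ψ (-a₁) (-b₁))] at hlip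
  antitone_left b _ _ ha := neg_le_neg (h.antitone_left (-b) (neg_le_neg ha))
  antitone_right a _ _ hb := neg_le_neg (h.antitone_right (-a) (neg_le_neg hb))

lemma IsCompetitive.right_nonneg (h : IsCompetitive Ψu Ψv Ψ) : 0 ≤ Ψv := by
  simpa using (abs_nonneg _).trans (h.lipschitz 0 0 1 0)

lemma IsCompetitive.le_mul_max (h : IsCompetitive Ψu Ψv Ψ) (hkl : Ψ k l ≤ 0) (b : ℝ) :
    Ψ k b ≤ Ψv * max (l - b) 0 :=
  calc Ψ k b ≤ Ψ k (min b l) := h.antitone_right k (min_le_left b l)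
    _ ≤ Ψ k (min b l) - Ψ k l := le_sub_self_iff _ |>.2 hkl
    _ ≤ Ψv * |min b l - l| := by
        simpa using (le_abs_self _).trans (h.lipschitz k k (min b l) l)
    _ = Ψv * max (l - b) 0 := by
        rw [abs_sub_comm, abs_of_nonneg (sub_nonneg.2 (min_le_right b l)), ← max_sub_sub_left,
          sub_self]

lemma IsCompetitive.mul_max_le (h : IsCompetitive Ψu Ψv Ψ) (hkl : Ψ k l ≤ 0) (a b : ℝ) :
    Ψ a b * max (a - k) 0 ≤ Ψv * (max (a - k) 0 * max (l - b) 0) := by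
  rcases le_total a k with hak | hka
  · rw [max_eq_right (sub_nonpos.2 hak), mul_zero, zero_mul, mul_zero]
  · calc Ψ a b * max (a - k) 0 ≤ Ψv * max (l - b) 0 * max (a - k) 0 :=
          mul_le_mul_of_nonneg_right ((h.antitone_left b hka).trans (h.le_mul_max hkl b))
            (le_max_right _ _)
      _ = Ψv * (max (a - k) 0 * max (l - b) 0) := by ring

lemma IsCompetitive.neg_mul_max_le (h : IsCompetitive Ψu Ψv Ψ) (hkl : 0 ≤ Ψ k l) (a b : ℝ) :
    -Ψ a b * max (-b - -l) 0 ≤ Ψu * (max (a - k) 0 * max (-b - -l) 0) := by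
  have hle := h.neg.swap.mul_max_le (k := -l) (l := -k) (by simpa only [neg_neg, neg_nonpos])
    (-b) (-a)
  rwa [neg_neg, neg_neg, neg_sub_neg k, mul_comm (max (-b - -l) 0)] at hle

end Competition

section Comparison

variable {T L M : ℝ}

lemma ae_eq_zero_and_eq_zero_of_half_sq_norm_le {α : Type*} [MeasurableSpace α] {μ : Measure α}
    {P Q : ℝ → Lp ℝ 2 μ} (hP : MemLp P 2 (timeMeasure T)) (hQ : MemLp Q 2 (timeMeasure T))
    (hP0 : ∀ t, 0 ≤ᵐ[μ] P t) (hQ0 : ∀ t, 0 ≤ᵐ[μ] Q t) (hL : 0 ≤ L) (hM : 0 ≤ M)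
    {f g : ℝ → α → ℝ} (hf : ∀ᵐ t ∂timeMeasure T, ∀ᵐ x ∂μ, f t x ≤ L * (P t x * Q t x))
    (hg : ∀ᵐ t ∂timeMeasure T, ∀ᵐ x ∂μ, g t x ≤ M * (P t x * Q t x))
    (hPf : ∀ᵐ s ∂timeMeasure T, ‖P s‖ ^ 2 / 2 ≤ ∫ t in (0 : ℝ)..s, ∫ x, f t x ∂μ)
    (hQg : ∀ᵐ s ∂timeMeasure T, ‖Q s‖ ^ 2 / 2 ≤ ∫ t in (0 : ℝ)..s, ∫ x, g t x ∂μ) :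
    ∀ᵐ t ∂timeMeasure T, P t = 0 ∧ Q t = 0 := by
  set E : ℝ → ℝ := fun t => ‖P t‖ ^ 2 / 2 + ‖Q t‖ ^ 2 / 2
  have hE : Integrable E (timeMeasure T) :=
    (integrable_half_sq_norm hP).add (integrable_half_sq_norm hQ)
  have hE0 : ∀ t, 0 ≤ E t := fun t => by positivity
  have hgronwall : ∀ᵐ s ∂timeMeasure T, E s ≤ (L + M) * ∫ t in (0 : ℝ)..s, E t := by
    filter_upwards [hPf, hQg, ae_restrict_mem measurableSet_Ioo] with s hPs hQs hs
    rw [add_mul]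
    exact add_le_add
      (hPs.trans (intervalIntegral_le_const_mul_of_ae_le hs hL hE hE0
        (hf.mono fun t => integral_le_mul_half_sq_norm_add hL (hP0 t) (hQ0 t))))
      (hQs.trans (intervalIntegral_le_const_mul_of_ae_le hs hM hE hE0
        (hg.mono fun t => integral_le_mul_half_sq_norm_add hM (hP0 t) (hQ0 t))))
  filter_upwards [ae_eq_zero_of_ae_le_mul_primitive hE hE0 hgronwall] with t ht
  rw [add_eq_zero_iff_of_nonneg (by positivity) (by positivity)] at ht
  simpa using ht

end Comparison

section Negation

variable {d : ℕ} {Ω : Set (Euc d)} {T : ℝ}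

lemma HasWeakTimeDeriv.neg {X : Type*} [NormedAddCommGroup X] [NormedSpace ℝ X]
    {f g : ℝ → X} (h : HasWeakTimeDeriv T f g) :
    HasWeakTimeDeriv T (fun t => -f t) fun t => -g t := by
  intro η hη
  simp only [smul_neg, integral_neg, h η hη]

lemma HasInitialValue.neg {w : ℝ → Euc d → ℝ} {w₀ : Euc d → ℝ} (h : HasInitialValue Ω w w₀) :
    HasInitialValue Ω (fun t x => -w t x) fun x => -w₀ x := by
  refine h.congr fun t => ?_
  rw [← eLpNorm_neg, neg_sub']
  rfl

lemma Represents.neg {w : ℝ → Euc d → ℝ} {W : ℝ → L2 Ω} (h : Represents Ω T w W) :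
    Represents Ω T (fun t x => -w t x) fun t => -W t :=
  ⟨h.1.neg, h.2.mono fun t ht => ht.neg.trans (Lp.coeFn_neg (W t)).symm⟩

lemma L2.toHneg1_neg (f : L2 Ω) : L2.toHneg1 (-f) = -L2.toHneg1 f := by
  rw [L2.toHneg1, map_neg, ContinuousLinearMap.neg_comp, L2.toHneg1]

lemma IsWeakParabolicEquation.neg {a : ℝ → Euc d → ℝ} {f : ℝ → Euc d → Euc d}
    {r : ℝ → Euc d → ℝ} {U : ℝ → H10 Ω} {U' : ℝ → Hneg1 Ω}
    (h : IsWeakParabolicEquation T a f r U U') :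
    IsWeakParabolicEquation T a (fun t x => -f t x) (fun t x => -r t x) (fun t => -U t)
      fun t => -U' t := by
  intro φ hφ
  have hdiffusion : ∀ t, ∫ x in Ω, a t x * ⟪(-U t).1.snd x, (φ t).1.snd x⟫
      = -∫ x in Ω, a t x * ⟪(U t).1.snd x, (φ t).1.snd x⟫ := by
    intro t
    rw [← integral_neg]
    refine integral_congr_ae ?_
    filter_upwards [Lp.coeFn_neg (U t).1.snd] with x hx
    rw [show (-U t).1.snd = -(U t).1.snd from rfl, hx, Pi.neg_apply, inner_neg_left, mul_neg]
  simp only [hdiffusion, _root_.neg_apply, inner_neg_left, neg_mul, integral_neg]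
  linarith [h φ hφ]

lemma IsWeakRateEquation.neg {r : ℝ → Euc d → ℝ} {V' : ℝ → L2 Ω}
    (h : IsWeakRateEquation T r V') :
    IsWeakRateEquation T (fun t x => -r t x) fun t => -V' t := by
  intro ξ hξ
  have hξ' := h ξ hξ
  simp only [← L2_inner_eq_integral_mul] at hξ' ⊢
  simp only [inner_neg_left, neg_mul, integral_neg, hξ']

variable {D : ℝ → ℝ → ℝ} {F : ℝ → ℝ → Euc d} {Ψ₁ Ψ₂ : ℝ → ℝ → ℝ} {u₀ v₀ : Euc d → ℝ}
  {u v : ℝ → Euc d → ℝ}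

lemma IsWeakSolution.neg (h : IsWeakSolution Ω T D F Ψ₁ Ψ₂ u₀ v₀ u v) :
    IsWeakSolution Ω T (fun a b => D (-a) (-b)) (fun a b => -F (-a) (-b))
      (fun a b => -Ψ₁ (-a) (-b)) (fun a b => -Ψ₂ (-a) (-b)) (fun x => -u₀ x) (fun x => -v₀ x)
      (fun t x => -u t x) fun t x => -v t x := by
  obtain ⟨U, V, U', V', hu, hU, hU', hUd, hv, hV, hV', hVd, hui, hvi, hequ, heqv⟩ := h
  have hUd_neg : HasWeakTimeDeriv T (fun t => L2.toHneg1 (-(U t).1.fst)) fun t => -U' t := by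
    simp only [L2.toHneg1_neg]
    exact hUd.neg
  refine ⟨fun t => -U t, fun t => -V t, fun t => -U' t, fun t => -V' t, hu.neg, hU.neg,
    MemLp.neg (E := H10 Ω →L[ℝ] ℝ) hU', hUd_neg, hv.neg, hV.neg, hV'.neg, hVd.neg, hui.neg, hvi.neg,
    ?_, ?_⟩
  · simp only [neg_neg]
    exact IsWeakParabolicEquation.neg hequ
  · simp only [neg_neg]
    exact IsWeakRateEquation.neg heqv

end Negation

section MaximumPrinciple

variable {d : ℕ} {Ω : Set (Euc d)} {T Ψu Ψv : ℝ} {D : ℝ → ℝ → ℝ} {F : ℝ → Euc d}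
  {Ψ₁ Ψ₂ : ℝ → ℝ → ℝ} {u₀ v₀ : Euc d → ℝ} {u v : ℝ → Euc d → ℝ}

theorem IsWeakSolution.ae_le_and_le [IsFiniteMeasure (volume.restrict Ω)]
    (h : IsWeakSolution Ω T D (fun a _ => F a) Ψ₁ Ψ₂ u₀ v₀ u v) (hT : 0 < T)
    (hD : ∀ a b, 0 ≤ D a b) (hF : Continuous F) {C : ℝ} (hC : ∀ s, ‖F s‖ ≤ C)
    (hΨ₁ : IsCompetitive Ψu Ψv Ψ₁) (hΨ₂ : IsCompetitive Ψu Ψv Ψ₂) {k l : ℝ} (hk : 0 ≤ k)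
    (h₁ : Ψ₁ k l ≤ 0) (h₂ : 0 ≤ Ψ₂ k l) (hu₀ : ∀ᵐ x ∂(volume.restrict Ω), u₀ x ≤ k)
    (hv₀ : ∀ᵐ x ∂(volume.restrict Ω), l ≤ v₀ x) :
    ∀ᵐ t ∂(timeMeasure T), ∀ᵐ x ∂(volume.restrict Ω), u t x ≤ k ∧ l ≤ v t x := by
  obtain ⟨U, V, U', V', hu, hU, hU', hUd, hv, hV, hV', hVd, hui, hvi, hequ, heqv⟩ := h
  have hU2 : MemLp (fun t => (U t).1.fst) 2 (timeMeasure T) :=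
    ((WithLp.fstL 2 ℝ (L2 Ω) (L2Vec Ω)).comp (H10 Ω).subtypeL).comp_memLp' hU
  have hV2 : MemLp (fun t => -(V t).1.fst) 2 (timeMeasure T) :=
    (((WithLp.fstL 2 ℝ (L2 Ω) (L2Vec Ω)).comp (H1 Ω).subtypeL).comp_memLp' hV).neg
  have hPle := IsWeakParabolicEquation.ae_half_sq_norm_excess_le hequ hT hU hU' hUd
    (fun t x => hD _ _) hF hC (hu.2.mono fun t ht => ht.mono fun x hx => congrArg F hx) hk
    (hui.tendsto_half_sq_norm_excess hT hu.2 hu₀)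
  have hQle := (IsWeakRateEquation.neg heqv).ae_half_sq_norm_excess_le hT hV2 hV'.neg hVd.neg
    (hvi.neg.tendsto_half_sq_norm_excess hT hv.neg.2 (hv₀.mono fun x => neg_le_neg))
  have hP : ∀ᵐ t ∂timeMeasure T, excess k (U t).1.fst
      =ᵐ[volume.restrict Ω] fun x => max (u t x - k) 0 :=
    hu.2.mono fun t ht => coeFn_excess_of_ae_eq k ht
  have hQ : ∀ᵐ t ∂timeMeasure T, excess (-l) (-(V t).1.fst)
      =ᵐ[volume.restrict Ω] fun x => max (-v t x - -l) 0 :=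
    hv.neg.2.mono fun t ht => coeFn_excess_of_ae_eq (-l) ht
  have hzero := ae_eq_zero_and_eq_zero_of_half_sq_norm_le (memLp_excess k hU2)
    (memLp_excess (-l) hV2) (fun t => excess_nonneg k _) (fun t => excess_nonneg (-l) _)
    hΨ₁.right_nonneg hΨ₂.swap.right_nonneg
    (by
      filter_upwards [hP, hQ] with t hPt hQt
      filter_upwards [hPt, hQt] with x hPx hQx
      rw [hPx, hQx, neg_sub_neg]
      exact hΨ₁.mul_max_le h₁ _ _)
    (by
      filter_upwards [hP, hQ] with t hPt hQt
      filter_upwards [hPt, hQt] with x hPx hQx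
      rw [hPx, hQx]
      exact hΨ₂.neg_mul_max_le h₂ _ _) hPle hQle
  filter_upwards [hzero, hu.2, hv.neg.2] with t ht hut hvt
  filter_upwards [ae_le_of_excess_eq_zero ht.1, ae_le_of_excess_eq_zero ht.2, hut, hvt]
    with x hux hvx hu_eq hv_eq
  exact ⟨hu_eq.trans_le hux, neg_le_neg_iff.1 (hv_eq.trans_le hvx)⟩

lemma ae_prod_mem_of_ae_ae_mem {α β : Type*} [MeasurableSpace α] [MeasurableSpace β]
    {μ : Measure α} {ν : Measure β} [SFinite ν] {E : Type*} [TopologicalSpace E]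
    [TopologicalSpace.PseudoMetrizableSpace E] [MeasurableSpace E] [BorelSpace E] {w : α → β → E}
    (hw : AEStronglyMeasurable (Function.uncurry w) (μ.prod ν)) {S : Set E} (hS : MeasurableSet S)
    (h : ∀ᵐ t ∂μ, ∀ᵐ x ∂ν, w t x ∈ S) : ∀ᵐ z ∂(μ.prod ν), w z.1 z.2 ∈ S := by
  have hmk : ∀ᵐ z ∂(μ.prod ν), hw.mk _ z ∈ S := by
    rw [Measure.ae_prod_iff_ae_ae (hw.stronglyMeasurable_mk.measurable hS)]
    filter_upwards [h, Measure.ae_ae_of_ae_prod hw.ae_eq_mk] with t ht heq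
    filter_upwards [ht, heq] with x hx heqx
    rwa [← heqx]
  filter_upwards [hmk, hw.ae_eq_mk] with z hz heqz
  rwa [← heqz] at hz

lemma ae_mem_Icc_essInf_essSup {α : Type*} [MeasurableSpace α] {μ : Measure α}
    {f : α → ℝ} (hf : MemLp f ⊤ μ) : ∀ᵐ x ∂μ, f x ∈ Icc (essInf f μ) (essSup f μ) := by
  have hbound : ∀ᵐ x ∂μ, |f x| ≤ (eLpNormEssSup f μ).toReal := by
    filter_upwards [enorm_ae_le_eLpNormEssSup f μ] with x hx
    rw [← eLpNorm_exponent_top] at hx ⊢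
    simpa using ENNReal.toReal_mono hf.eLpNorm_ne_top hx
  filter_upwards [ae_essInf_le ⟨_, eventually_map.2 (hbound.mono fun x hx => (abs_le.1 hx).1)⟩,
    ae_le_essSup ⟨_, eventually_map.2 (hbound.mono fun x hx => (abs_le.1 hx).2)⟩] with x hinf hsup
  exact ⟨hinf, hsup⟩

theorem mainTheorem2_general (hΩ : volume Ω ≠ ⊤) (hT : 0 < T)
    (hD : Measurable (Function.uncurry D) ∧ ∃ DM, ∀ a b, D a b ∈ Icc 0 DM)
    (hF : Continuous F) (hF_bdd : ∃ FM, ∀ a, ‖F a‖ ≤ FM)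
    (hΨ₁ : IsCompetitive Ψu Ψv Ψ₁) (hΨ₂ : IsCompetitive Ψu Ψv Ψ₂)
    {ul ur vl vr : ℝ} (hul : ul ≤ 0) (hur : 0 ≤ ur)
    (hu₀ : ∀ᵐ x ∂(volume.restrict Ω), u₀ x ∈ Icc ul ur)
    (hv₀ : ∀ᵐ x ∂(volume.restrict Ω), v₀ x ∈ Icc vl vr)
    (h_r : Ψ₁ ur vl ≤ 0 ∧ 0 ≤ Ψ₂ ur vl) (h_l : Ψ₂ ul vr ≤ 0 ∧ 0 ≤ Ψ₁ ul vr)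
    (huv : IsWeakSolution Ω T D (fun a _ => F a) Ψ₁ Ψ₂ u₀ v₀ u v) :
    ∀ᵐ z : ℝ × Euc d ∂((timeMeasure T).prod (volume.restrict Ω)),
      v z.1 z.2 ∈ Icc vl vr ∧ u z.1 z.2 ∈ Icc ul ur := by
  have : IsFiniteMeasure (volume.restrict Ω) := isFiniteMeasure_restrict.2 hΩ
  obtain ⟨-, DM, hDM⟩ := hD
  obtain ⟨FM, hFM⟩ := hF_bdd
  have hupper := huv.ae_le_and_le hT (fun a b => (hDM a b).1) hF hFM hΨ₁ hΨ₂ hur h_r.1 h_r.2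
    (hu₀.mono fun x hx => hx.2) (hv₀.mono fun x hx => hx.1)
  have hlower := huv.neg.ae_le_and_le (F := fun a => -F (-a)) hT (fun a b => (hDM _ _).1)
    (by fun_prop) (fun s => (norm_neg _).trans_le (hFM (-s))) hΨ₁.neg hΨ₂.neg (k := -ul) (l := -vr)
    (neg_nonneg.2 hul) (by simpa using h_l.2) (by simpa using h_l.1)
    (hu₀.mono fun x hx => neg_le_neg hx.1) (hv₀.mono fun x hx => neg_le_neg hx.2)
  obtain ⟨_, _, _, _, hu, _, _, _, hv, _⟩ := huv
  refine ae_prod_mem_of_ae_ae_mem (w := fun t x => (v t x, u t x)) (hv.1.prodMk hu.1)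
    (measurableSet_Icc.prod measurableSet_Icc) ?_
  filter_upwards [hupper, hlower] with t hut hlt
  filter_upwards [hut, hlt] with x hux hlx
  exact ⟨⟨hux.2, neg_le_neg_iff.1 hlx.2⟩, neg_le_neg_iff.1 hlx.1, hux.1⟩

end MaximumPrinciple

theorem mainTheorem2 {d : ℕ} (Ω : Set (Euc d)) (hΩ_open : IsOpen Ω) (hΩ_conn : IsConnected Ω)
    (hΩ_bdd : Bornology.IsBounded Ω) (hΩ_C1 : HasC1Boundary Ω)
    (T : ℝ) (hT : 0 < T)
    (D : ℝ → ℝ → ℝ) (F : ℝ → ℝ → Euc d) (Ψ₁ Ψ₂ : ℝ → ℝ → ℝ) (u₀ v₀ : Euc d → ℝ)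
    -- diffusivity
    (hD : ContDiff ℝ 1 (Function.uncurry D))
    (hD_bdd : ∃ Dm DM : ℝ, 0 < Dm ∧ ∀ a b, Dm ≤ D a b ∧ D a b ≤ DM)
    -- flux
    (hF : ∀ j, ContDiff ℝ 1 (fun p : ℝ × ℝ => F p.1 p.2 j))
    (hF_bdd : ∃ FM : ℝ, 0 < FM ∧ ∀ a b, ‖F a b‖ ≤ FM)
    -- reaction terms: Lipschitz, and nonincreasing in each variable
    (hΨ : ∃ Ψu Ψv : ℝ, 0 < Ψu ∧ 0 < Ψv ∧ ∀ a₁ a₂ b₁ b₂,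
      |Ψ₁ a₁ b₁ - Ψ₁ a₂ b₂| ≤ Ψu * |a₁ - a₂| + Ψv * |b₁ - b₂| ∧
      |Ψ₂ a₁ b₁ - Ψ₂ a₂ b₂| ≤ Ψu * |a₁ - a₂| + Ψv * |b₁ - b₂|)
    (hΨ₁_u : ∀ b, Antitone (fun a => Ψ₁ a b)) (hΨ₁_v : ∀ a, Antitone (Ψ₁ a))
    (hΨ₂_u : ∀ b, Antitone (fun a => Ψ₂ a b)) (hΨ₂_v : ∀ a, Antitone (Ψ₂ a))
    -- initial data; the last condition is `Ψ₂(0, v₀) = 0` on `∂Ω`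
    (hu₀ : MemLp u₀ ∞ (volume.restrict Ω))
    (hv₀ : MemLp v₀ ∞ (volume.restrict Ω)) (hv₀_H1 : MemH1 Ω v₀)
    (hv₀_bdry : MemH10 Ω (fun x => Ψ₂ 0 (v₀ x)))
    -- hypotheses of the maximum principle
    (hF_u : ∀ a b b', F a b = F a b')
    (vl vr : ℝ) (hvl : vl = essInf v₀ (volume.restrict Ω))
    (hvr : vr = essSup v₀ (volume.restrict Ω))
    (ul ur : ℝ) (hul_ur : ul < ur) (hul : ul ≤ 0) (hur : 0 ≤ ur)
    (hu₀_mem : ∀ᵐ x ∂(volume.restrict Ω), u₀ x ∈ Icc ul ur)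
    (h_r : Ψ₁ ur vl ≤ 0 ∧ 0 ≤ Ψ₂ ur vl) (h_l : Ψ₂ ul vr ≤ 0 ∧ 0 ≤ Ψ₁ ul vr)
    (u v : ℝ → Euc d → ℝ) (huv : IsWeakSolution Ω T D F Ψ₁ Ψ₂ u₀ v₀ u v) :
    ∀ᵐ z : ℝ × Euc d ∂((volume.restrict (Ioo 0 T)).prod (volume.restrict Ω)),
      (vl ≤ v z.1 z.2 ∧ v z.1 z.2 ≤ vr) ∧ (ul ≤ u z.1 z.2 ∧ u z.1 z.2 ≤ ur) := by
  obtain ⟨Dm, DM, hDm, hD_mem⟩ := hD_bdd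
  obtain ⟨FM, -, hFM⟩ := hF_bdd
  obtain ⟨Ψu, Ψv, -, -, hlip⟩ := hΨ
  have hF_cont : Continuous fun a => F a 0 :=
    (PiLp.continuous_toLp 2 _).comp
      (continuous_pi fun j => (hF j).continuous.comp (Continuous.prodMk_left 0))
  have hF_eq : F = fun a _ => F a 0 := funext₂ fun a b => hF_u a b 0
  rw [hF_eq] at huv
  subst hvl hvr
  exact mainTheorem2_general hΩ_bdd.measure_lt_top.ne hT
    ⟨hD.continuous.measurable, DM, fun a b => ⟨hDm.le.trans (hD_mem a b).1, (hD_mem a b).2⟩⟩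
    hF_cont ⟨FM, fun a => hFM a 0⟩
    ⟨fun a₁ a₂ b₁ b₂ => (hlip a₁ a₂ b₁ b₂).1, hΨ₁_u, hΨ₁_v⟩
    ⟨fun a₁ a₂ b₁ b₂ => (hlip a₁ a₂ b₁ b₂).2, hΨ₂_u, hΨ₂_v⟩ hul hur hu₀_mem
    (ae_mem_Icc_essInf_essSup hv₀) h_r h_l huv
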